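/- **Impact.** Let $G$ be a finite simple undirected graph with $n$ vertices and $v$ a vertex. Removing $v$ splits the connected component of $v$ into pieces (the connected components of $G-v$ contained in it). The *impact* of $v$ is the sum of the sizes of all pieces minus the size of a largest one, that is, the number of vertices cut off from the largest piece ($0$ if there is no piece). **Block Forest.** A block of $G$ is a maximal set $B$ of at least two vertices such that $G[B]$ is connected and $G[B\setminus\{x\}]$ is connected for all $x\in B$. The Block Forest of $G$ has a square node for each vertex and a round node for each block, a square and a round node being adjacent iff the vertex lies in the block. Square nodes have value $1$, round nodes value $0$. The forest is rooted, and the children of each node are ordered, arbitrarily. **DFT-Tree.** The depth first tour of a rooted ordered tree lists an open-node of each tree node when the depth first visit enters it and a close-node when the visit leaves it. A DFT-Tree of a forest is a collection of binary search trees stored in memory; each holds, in left-to-right order, the concatenated tours of one or more trees of the forest, and each tree of the forest is held exactly once. The search trees are balanced: for a constant $K$, a search tree with $N$ nodes has height at most $K(\lfloor\log_2 N\rfloor+1)$ (as for red-black trees, $K=2$). Each search tree node stores pointers to its left child, right child, parent, and twin (the other tour entry of the same tree node), whether it is an open- or a close-node, the value of its tree node, and a summary of the sequence of parentheses in its search subtree.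 With the depth of a parenthesis being the number of open minus closed parentheses up to and including it, the summary consists of: the minimum $a$ of $0$ and all depths; the depth of the last parenthesis ($0$ for the empty sequence) minus $a$; a pointer to the leftmost parenthesis of depth $a$, if any; and the sums of values (counted at open-nodes) in the prefix, in the body and in the suffix, and the maximum ($0$ if the body is empty), over the subtrees the body consists of, of the sum of values in the subtree. Here the prefix ends at the leftmost parenthesis of depth $a$ (it is empty if $a=0$), the body is the longest balanced piece following it, and the suffix is the rest. **Operations.** $\mathrm{root}(v)$ is the root of the tree containing $v$; $\mathrm{subtree\text{-}size}(v)$ is the sum of the values in the subtree of $v$; $\text{reduce-child-subtrees}(v,\oplus,\otimes)=\Sigma(c_1)\otimes\cdots\otimes\Sigma(c_d)$, where $c_1,\dots,c_d$ are the children of $v$ and $\Sigma(c)$ is the $\oplus$-combination of the values in the subtree of $c$; and $\text{maxsum-child}(v)=\text{reduce-child-subtrees}(v,+,\max)$ ($0$ if $v$ has no children). **Lemma (impact queries).** There is one fixed program (for a register machine with integer registers, in which an assignment, an addition, a subtraction, a comparison, or the reading of a field of a memory record takes one step) such that for each $K$ there is a constant $C$ with the following property. Let $G$ be a graph with $n$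 vertices (in a streaming graph, the graph at any moment), let a DFT-Tree of its Block Forest with balance constant $K$ be stored in memory, and let $v$ be a vertex of $G$. Given the address of the open-node of $v$, the program returns the impact of $v$ after at most $C\log(n+1)$ steps. Within these steps it also returns $\mathrm{root}(v)$, $S=\mathrm{subtree\text{-}size}(\mathrm{root}(v))$, $s=\mathrm{subtree\text{-}size}(v)$ and $m=\text{maxsum-child}(v)$, and $$\mathrm{impact}(v)=(S-1)-\max(m,\;S-s).$$ -/

import Mathlib

namespace DFT

/-! ### Impact of a vertex of a graph -/

/-- The connected components of `G - v` that are contained in the connected component of `v`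
in `G`: the pieces into which the component of `v` falls apart when `v` is removed. -/
def pieces {V : Type*} (G : SimpleGraph V) (v : V) :
    Set (G.induce ({v}ᶜ : Set V)).ConnectedComponent :=
  {c | ∃ u ∈ c.supp, G.Reachable v u}

/-- The impact of `v`: the number of vertices that get disconnected from the largest piece when
`v` is removed, i.e. the sum of the sizes of all pieces except the largest one. -/
noncomputable def impact {V : Type*} [Fintype V] (G : SimpleGraph V) (v : V) : ℕ :=
  (∑ c ∈ (pieces G v).toFinite.toFinset, c.supp.ncard) -
    (pieces G v).toFinite.toFinset.sup (fun c => c.supp.ncard)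

/-! ### The Block Forest -/

/-- `B` induces a connected subgraph on at least two vertices that stays connected after the
removal of any one of its vertices. A single edge qualifies. -/
def IsBiconnectedSet {V : Type*} (G : SimpleGraph V) (B : Set V) : Prop :=
  B.Nontrivial ∧ (G.induce B).Preconnected ∧ ∀ x ∈ B, (G.induce (B \ {x})).Preconnected

/-- Biconnected components (blocks): maximal biconnected vertex sets. A bridge is a block, and an
isolated vertex lies in no block. -/
def IsBlock {V : Type*} (G : SimpleGraph V) (B : Set V) : Prop :=
  Maximal (IsBiconnectedSet G) B

/-- Nodes of the Block Forest: a square node `Sum.inl v` for each vertex `v` of the graph, and a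
round node `Sum.inr B` for each biconnected component `B`. -/
abbrev BlockNode {V : Type*} (G : SimpleGraph V) : Type _ := V ⊕ {B : Set V // IsBlock G B}

/-- The Block Forest: a square node and a round node are adjacent iff the vertex belongs to the
biconnected component. -/
def blockForest {V : Type*} (G : SimpleGraph V) : SimpleGraph (BlockNode G) where
  Adj
    | Sum.inl v, Sum.inr B => v ∈ B.1
    | Sum.inr B, Sum.inl v => v ∈ B.1
    | _, _ => False
  symm := ⟨by rintro (v | B) (w | B') h <;> exact h⟩
  loopless := ⟨by rintro (v | B) h <;> exact h⟩

/-- The value stored in a node: 1 in square nodes, 0 in round nodes. -/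
def blockVal {V : Type*} (G : SimpleGraph V) : BlockNode G → ℕ :=
  Sum.elim (fun _ => 1) (fun _ => 0)

/-! ### Rooted ordered forests and their depth first tours -/

/-- Rooted ordered forests. `node a c s` is the forest whose first tree has root `a` and
the trees of `c` as the subtrees of the children of `a`, followed by the trees of `s`. -/
inductive OForest (α : Type*) where
  | nil : OForest α
  | node (a : α) (children siblings : OForest α) : OForest α

/-- An entry of a depth first tour: the open-node or the close-node of a tree node. -/
structure Paren (α : Type*) where
  node : α
  isOpen : Bool

/-- The other tour entry of the same tree node. -/
def Paren.twin {α : Type*} (p : Paren α) : Paren α := ⟨p.node, !p.isOpen⟩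

namespace OForest

/-- Nodes of a forest, in preorder. -/
def nodes {α : Type*} : OForest α → List α
  | nil => []
  | node a c s => a :: (c.nodes ++ s.nodes)

/-- Roots of the trees of a forest. -/
def roots {α : Type*} : OForest α → List α
  | nil => []
  | node a _ s => a :: s.roots

/-- Disjoint union of two forests. -/
def append {α : Type*} : OForest α → OForest α → OForest α
  | nil, g => g
  | node a c s, g => node a c (s.append g)

/-- `f.IsChild p x`: the node `x` is a child of the node `p`. -/
def IsChild {α : Type*} : OForest α → α → α → Prop
  | nil, _, _ => False
  | node a c s, p, x => (p = a ∧ x ∈ c.roots) ∨ c.IsChild p x ∨ s.IsChild p x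

/-- The depth first tour (parenthetical sequence). -/
def tour {α : Type*} : OForest α → List (Paren α)
  | nil => []
  | node a c s => ⟨a, true⟩ :: (c.tour ++ ⟨a, false⟩ :: s.tour)

/-- The node sets, in preorder, of the trees of a forest. -/
def treeNodes {α : Type*} : OForest α → List (List α)
  | nil => []
  | node a c s => (a :: c.nodes) :: s.treeNodes

open Classical in
/-- The forest formed by the subtrees rooted in the children of `v`. -/
noncomputable def childSubtrees {α : Type*} : OForest α → α → OForest α
  | nil, _ => nil
  | node a c s, v =>
    if v = a then c else if v ∈ c.nodes then c.childSubtrees v else s.childSubtrees v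

open Classical in
/-- ROOT: the root of the tree that contains `v` (`none` if `v` is not a node of the forest). -/
noncomputable def rootOf {α : Type*} : OForest α → α → Option α
  | nil, _ => none
  | node a c s, v => if v = a ∨ v ∈ c.nodes then some a else s.rootOf v

/-- SUBTREE-SIZE (SUBTREE-SUM): the sum of the values of the nodes in the subtree of `v`. -/
noncomputable def subtreeSum {α : Type*} (f : OForest α) (val : α → ℕ) (v : α) : ℕ :=
  ((v :: (f.childSubtrees v).nodes).map val).sum

end OForest

/-- `x₁ ⊕ x₂ ⊕ ⋯ ⊕ xₘ`; there is no value for the empty list. -/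
def reduce {β : Type*} (op : β → β → β) : List β → Option β
  | [] => none
  | x :: l => some (l.foldl op x)

namespace OForest

/-- REDUCE-CHILD-SUBTREES `(v, ⊕, ⊗)`: the value `Σ(c₁) ⊗ ⋯ ⊗ Σ(c_d)`, where `c₁, …, c_d` are the
children of `v` and `Σ(c)` is the `⊕`-combination of the values in the subtree of `c`. -/
noncomputable def reduceChildSubtrees {α β : Type*} (f : OForest α) (val : α → β)
    (op₁ op₂ : β → β → β) (v : α) : Option β :=
  reduce op₂ ((f.childSubtrees v).treeNodes.filterMap (fun l => reduce op₁ (l.map val)))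

/-- MAXSUM-CHILD: REDUCE-CHILD-SUBTREES with `(+, max)`, and 0 if there are no children. -/
noncomputable def maxsumChild {α : Type*} (f : OForest α) (val : α → ℕ) (v : α) : ℕ :=
  (f.reduceChildSubtrees val (· + ·) max v).getD 0

end OForest

/-! ### Summaries of sequences of parentheses -/

/-- The summary of a sequence of parentheses, with the extra information for LCA/ROOT and for
REDUCE-CHILD-SUBTREES with `(+, max)`. The depth of a parenthesis is the number of open minus the
number of closed parentheses in the prefix ending in it. The *prefix* of the sequence ends at
the leftmost parenthesis of depth `down` (it is empty if `down = 0`), the *body* is the longest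
balanced piece that follows it, and the *suffix* is the rest. Values are counted at the
open-nodes. -/
@[ext]
structure Summary (α : Type*) where
  /-- the minimum of 0 and the depths of all parentheses -/
  down : ℤ
  /-- the depth of the last parenthesis minus `down` -/
  up : ℤ
  /-- the leftmost parenthesis of depth `down`, if there is one -/
  first : Option (Paren α)
  /-- the sum of the values in the prefix -/
  prefixSum : ℕ
  /-- the sum of the values in the body -/
  bodySum : ℕ
  /-- the maximum, over the subtrees the body consists of, of the sum of the values -/
  bodyMax : ℕ
  /-- the sum of the values in the suffix -/
  suffixSum : ℕ

namespace Summary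

/-- The summary of the empty sequence. -/
def empty {α : Type*} : Summary α := ⟨0, 0, none, 0, 0, 0, 0⟩

/-- The summary of a single parenthesis. -/
def single {α : Type*} (val : α → ℕ) (p : Paren α) : Summary α :=
  if p.isOpen then ⟨0, 1, none, 0, 0, 0, val p.node⟩ else ⟨-1, 0, some p, 0, 0, 0, 0⟩

/-- The summary of a concatenation. When the suffix of the first sequence is closed exactly by the
prefix of the second one, the two together form one new subtree of the body. -/
def append {α : Type*} (s t : Summary α) : Summary α :=
  if 0 < s.up + t.down then
    ⟨s.down, s.up + t.down + t.up, s.first, s.prefixSum, s.bodySum, s.bodyMax,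
      s.suffixSum + t.prefixSum + t.bodySum + t.suffixSum⟩
  else if s.up + t.down = 0 then
    ⟨s.down, t.up, s.first.or t.first, s.prefixSum,
      s.bodySum + (s.suffixSum + t.prefixSum) + t.bodySum,
      max (max s.bodyMax (s.suffixSum + t.prefixSum)) t.bodyMax, t.suffixSum⟩
  else
    ⟨s.down + s.up + t.down, t.up, t.first,
      s.prefixSum + s.bodySum + s.suffixSum + t.prefixSum, t.bodySum, t.bodyMax, t.suffixSum⟩

/-- The summary of a sequence of parentheses. -/
def ofList {α : Type*} (val : α → ℕ) : List (Paren α) → Summary α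
  | [] => empty
  | p :: l => (single val p).append (ofList val l)

end Summary

/-! ### DFT-Trees in memory -/

/-- Left-to-right order of the entries of a binary search tree. -/
def inorder {β : Type*} : BinaryTree β → List β
  | .nil => []
  | .node b l r => inorder l ++ b :: inorder r

/-- One search tree of a DFT-Tree; it holds the depth first tours of one or more trees. -/
structure Part (α : Type*) where
  forest : OForest α
  bst : BinaryTree (Paren α)
  inorder_bst : inorder bst = forest.tour

/-- The forest represented by a collection of search trees. -/
def forestOf {α : Type*} : List (Part α) → OForest α
  | [] => .nil
  | p :: D => p.forest.append (forestOf D)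

/-- The rooted forest `f` is the graph `H` with some choice of roots and of orders of children. -/
def Represents {α : Type*} (f : OForest α) (H : SimpleGraph α) : Prop :=
  f.nodes.Nodup ∧ (∀ x, x ∈ f.nodes) ∧ ∀ x y, H.Adj x y ↔ f.IsChild x y ∨ f.IsChild y x

/-- The search trees have logarithmic height with constant `K`
(`K = 2` for red-black trees and for AVL trees). -/
def Balanced {α : Type*} (K : ℕ) (D : List (Part α)) : Prop :=
  ∀ p ∈ D, p.bst.height ≤ K * (Nat.log 2 p.bst.numNodes + 1)

/-- The fields of the memory record of a search tree node. -/
inductive Field where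
  | left | right | parent | twin
  | isOpen | val
  | down | up | first | prefixSum | bodySum | bodyMax | suffixSum

/-- Memory: the contents of each field of the record at each address. -/
abbrev Heap := ℤ → Field → ℤ

/-- The address of the root of a search tree; 0 is the null pointer. -/
def rootPtr {β : Type*} (addr : β → ℤ) : BinaryTree β → ℤ
  | .nil => 0
  | .node b _ _ => addr b

/-- The address of an optional entry; 0 is the null pointer. -/
def optPtr {β : Type*} (addr : β → ℤ) : Option β → ℤ
  | none => 0
  | some b => addr b

/-- The search tree `T`, whose root has its parent pointer equal to `par`, is stored in memory:
each node stores its pointers, its tag, its value, and the summary of the sequence of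
entries in its search subtree. -/
def StoredTree {α : Type*} (val : α → ℕ) (addr : Paren α → ℤ) (h : Heap) :
    ℤ → BinaryTree (Paren α) → Prop
  | _, .nil => True
  | par, .node p l r =>
    let a := addr p
    let s := Summary.ofList val (inorder (.node p l r))
    h a .left = rootPtr addr l ∧ h a .right = rootPtr addr r ∧
    h a .parent = par ∧ h a .twin = addr p.twin ∧
    h a .isOpen = (if p.isOpen then 1 else 0) ∧ h a .val = val p.node ∧
    h a .down = s.down ∧ h a .up = s.up ∧ h a .first = optPtr addr s.first ∧
    h a .prefixSum = s.prefixSum ∧ h a .bodySum = s.bodySum ∧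
    h a .bodyMax = s.bodyMax ∧ h a .suffixSum = s.suffixSum ∧
    StoredTree val addr h a l ∧ StoredTree val addr h a r

/-- The memory `h` holds a DFT-Tree `D` of the Block Forest of `G`, on top of search trees with
height constant `K`, where the tour entry `p` is stored at the address `addr p`. -/
structure IsBlockDFTTree {V : Type*} (G : SimpleGraph V) (K : ℕ) (D : List (Part (BlockNode G)))
    (addr : Paren (BlockNode G) → ℤ) (h : Heap) : Prop where
  represents : Represents (forestOf D) (blockForest G)
  balanced : Balanced K D
  addr_injective : Function.Injective addr
  addr_ne_null : ∀ p, addr p ≠ 0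
  stored : ∀ p ∈ D, StoredTree (blockVal G) addr h 0 p.bst

/-! ### Programs and running time -/

/-- Comparisons of registers. -/
inductive Cmp where
  | eq | ne | lt | le

/-- The truth value of a comparison. -/
def Cmp.Holds : Cmp → ℤ → ℤ → Prop
  | .eq, x, y => x = y
  | .ne, x, y => x ≠ y
  | .lt, x, y => x < y
  | .le, x, y => x ≤ y

/-- Programs of a register machine with read access to the memory. -/
inductive Prog where
  | skip : Prog
  | const (r : ℕ) (z : ℤ) : Prog
  | copy (r a : ℕ) : Prog
  | add (r a b : ℕ) : Prog
  | sub (r a b : ℕ) : Prog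
  | load (r a : ℕ) (f : Field) : Prog
  | seq (p q : Prog) : Prog
  | ite (c : Cmp) (a b : ℕ) (p q : Prog) : Prog
  | while (c : Cmp) (a b : ℕ) (p : Prog) : Prog

/-- Contents of the registers. -/
abbrev Regs := ℕ → ℤ

/-- `Exec h P s t s'`: with memory `h`, the program `P` started with register contents `s`
terminates after `t` steps with register contents `s'`. Every assignment, every memory access and
every comparison is one step. -/
inductive Exec (h : Heap) : Prog → Regs → ℕ → Regs → Prop
  | skip (s : Regs) : Exec h .skip s 0 s
  | const (s : Regs) (r : ℕ) (z : ℤ) : Exec h (.const r z) s 1 (Function.update s r z)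
  | copy (s : Regs) (r a : ℕ) : Exec h (.copy r a) s 1 (Function.update s r (s a))
  | add (s : Regs) (r a b : ℕ) : Exec h (.add r a b) s 1 (Function.update s r (s a + s b))
  | sub (s : Regs) (r a b : ℕ) : Exec h (.sub r a b) s 1 (Function.update s r (s a - s b))
  | load (s : Regs) (r a : ℕ) (f : Field) :
      Exec h (.load r a f) s 1 (Function.update s r (h (s a) f))
  | seq {p q : Prog} {s s' s'' : Regs} {t t' : ℕ} :
      Exec h p s t s' → Exec h q s' t' s'' → Exec h (.seq p q) s (t + t') s''
  | ite_true {c : Cmp} {a b : ℕ} {p q : Prog} {s s' : Regs} {t : ℕ} :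
      c.Holds (s a) (s b) → Exec h p s t s' → Exec h (.ite c a b p q) s (t + 1) s'
  | ite_false {c : Cmp} {a b : ℕ} {p q : Prog} {s s' : Regs} {t : ℕ} :
      ¬ c.Holds (s a) (s b) → Exec h q s t s' → Exec h (.ite c a b p q) s (t + 1) s'
  | while_true {c : Cmp} {a b : ℕ} {p : Prog} {s s' s'' : Regs} {t t' : ℕ} :
      c.Holds (s a) (s b) → Exec h p s t s' → Exec h (.while c a b p) s' t' s'' →
      Exec h (.while c a b p) s (t + t' + 1) s''
  | while_false {c : Cmp} {a b : ℕ} {p : Prog} {s : Regs} :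
      ¬ c.Holds (s a) (s b) → Exec h (.while c a b p) s 1 s

end DFT

/-! The impact formula comes from deleting a square node of the Block Forest. Two vertices other
than v are connected in G - v exactly when their square nodes are connected in the forest without
the node of v: every edge lies in a block, and a block stays connected when v is taken out of it
(`reflTransGen_adjIn_iff`). Deleting v from a rooted forest leaves the subtrees of its children and,
unless v is a root, one remaining part of its tree (`exists_remove`). Counted in square nodes, the
largest child subtree has size m, the remaining part S - s, and all of them together S - 1. This is
`impact_eq`.

The numbers are obtained from a monoid of summaries. Summarising is multiplicative
(`ofList_append`), so summaries stored in search subtrees can be combined along a path. The stretch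
of the tour strictly between the open-node and the close-node of v is the tour of the child
subtrees; it is balanced, so all of it is body, and its `bodySum` and `bodyMax` are the required sum
and maximum (`ofList_tour`). The stretch ends just before the first entry at which the depth falls
below its starting level. As `down` is a minimum of depths, one comparison tells whether a stored
subtree contains that entry. The walk therefore climbs, passing whole right subtrees as long as they
do not contain it, and then descends into the first one that does (`climb_found`, `descend_runs`). A
climb without target that starts at the close-node of v sees the whole rest of the tour, and the
leftmost entry of minimal depth there is the close-node of the root (`climb_through`,
`exists_tour_eq`).

Every iteration of a loop moves one level in a search tree, and a query makes three walks, so the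
time is linear in the height. Each block has a child vertex and no vertex has two parents, so the
forest has at most 2n nodes (`length_nodes_le`), and balance turns the height into O(log n). -/

namespace DFT

/-! ### The monoid of summaries -/

namespace Summary

variable {α : Type*}

/-- The invariants of summaries of sequences of parentheses. -/
structure Valid (s : Summary α) : Prop where
  down_nonpos : s.down ≤ 0
  up_nonneg : 0 ≤ s.up
  suffixSum_eq : s.up = 0 → s.suffixSum = 0
  prefixSum_eq : s.down = 0 → s.prefixSum = 0
  first_ne_none : s.down < 0 → s.first ≠ none

theorem valid_empty : (empty : Summary α).Valid := by
  constructor <;> simp [empty]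

theorem valid_single (val : α → ℕ) (p : Paren α) : (single val p).Valid := by
  unfold single
  constructor <;> split <;> simp

theorem Valid.append {s t : Summary α} (hs : s.Valid) (ht : t.Valid) : (s.append t).Valid := by
  obtain ⟨a1, a2, a3, a4, a5⟩ := hs
  obtain ⟨b1, b2, b3, b4, b5⟩ := ht
  unfold Summary.append
  split_ifs with h1 h2
  · exact ⟨a1, by simp; omega, by simp; omega, a4, a5⟩
  · refine ⟨a1, b2, b3, a4, fun h => ?_⟩
    have := a5 h
    cases hf : s.first <;> simp_all
  · exact ⟨by simp; omega, b2, b3, by simp; omega, fun h => b5 (by omega)⟩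

theorem valid_ofList (val : α → ℕ) : ∀ l : List (Paren α), (ofList val l).Valid
  | [] => valid_empty
  | p :: l => (valid_single val p).append (valid_ofList val l)

theorem append_of_pos {s t : Summary α} (h : 0 < s.up + t.down) :
    s.append t = ⟨s.down, s.up + t.down + t.up, s.first, s.prefixSum, s.bodySum, s.bodyMax,
      s.suffixSum + t.prefixSum + t.bodySum + t.suffixSum⟩ :=
  if_pos h

theorem append_of_eq {s t : Summary α} (h : s.up + t.down = 0) :
    s.append t = ⟨s.down, t.up, s.first.or t.first, s.prefixSum,
      s.bodySum + (s.suffixSum + t.prefixSum) + t.bodySum,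
      max (max s.bodyMax (s.suffixSum + t.prefixSum)) t.bodyMax, t.suffixSum⟩ := by
  rw [Summary.append, if_neg (by omega), if_pos h]

theorem append_of_neg {s t : Summary α} (h : s.up + t.down < 0) :
    s.append t = ⟨s.down + s.up + t.down, t.up, t.first,
      s.prefixSum + s.bodySum + s.suffixSum + t.prefixSum, t.bodySum, t.bodyMax, t.suffixSum⟩ := by
  rw [Summary.append, if_neg (by omega), if_neg (by omega)]

/-- This needs the invariants: if `down = 0`, the junction has depth 0 and `append` turns the prefix
into a subtree of the body, which is harmless only because `prefixSum` is then 0. -/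
theorem empty_append {s : Summary α} (hs : s.Valid) : empty.append s = s := by
  obtain ⟨a1, a2, a3, a4, a5⟩ := hs
  rcases a1.lt_or_eq with h | h
  · rw [append_of_neg (by simpa [empty] using h)]
    ext1 <;> simp [empty]
  · rw [append_of_eq (by simpa [empty] using h)]
    ext1 <;> simp_all [empty]

/-- Both bracketings are determined by the signs of the depths at the two junctions. In each case
the same pieces merge, and the fields agree by arithmetic. -/
theorem append_assoc {s t u : Summary α} (hs : s.Valid) (ht : t.Valid) (hu : u.Valid) :
    (s.append t).append u = s.append (t.append u) := by
  obtain ⟨a1, a2, a3, a4, a5⟩ := hs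
  obtain ⟨b1, b2, b3, b4, b5⟩ := ht
  obtain ⟨c1, c2, c3, c4, c5⟩ := hu
  rcases lt_trichotomy (s.up + t.down) 0 with h | h | h <;>
  rcases lt_trichotomy (t.up + u.down) 0 with h' | h' | h'
  · rw [append_of_neg h, append_of_neg h', append_of_neg, append_of_neg] <;> try (simp only; omega)
    ext1 <;> simp only <;> omega
  · rw [append_of_neg h, append_of_eq h', append_of_eq, append_of_neg] <;> try (simp only; omega)
  · rw [append_of_neg h, append_of_pos h', append_of_pos, append_of_neg] <;> try (simp only; omega)
  · rw [append_of_eq h, append_of_neg h', append_of_neg, append_of_neg] <;> try (simp only; omega)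
    ext1 <;> simp only <;> omega
  · rw [append_of_eq h, append_of_eq h', append_of_eq, append_of_eq] <;> try (simp only; omega)
    ext1 <;> simp only [Option.or_assoc] <;> omega
  · rw [append_of_eq h, append_of_pos h', append_of_pos, append_of_eq] <;> try (simp only; omega)
  -- The only sign pattern that leaves the outer junction undecided: `t` does not close the suffix
  -- of `s`, but `u` may close what `t` left open and more.
  · rw [append_of_pos h, append_of_neg h']
    rcases lt_trichotomy (s.up + t.down + t.up + u.down) 0 with h2 | h2 | h2
    · rw [append_of_neg, append_of_neg] <;> try (simp only; omega)
      ext1 <;> simp only <;> omega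
    · rw [append_of_eq, append_of_eq] <;> try (simp only; omega)
      ext1 <;> simp only <;> omega
    · rw [append_of_pos, append_of_pos] <;> try (simp only; omega)
      ext1 <;> simp only <;> omega
  · rw [append_of_pos h, append_of_eq h', append_of_pos, append_of_pos] <;> try (simp only; omega)
    ext1 <;> simp only <;> omega
  · rw [append_of_pos h, append_of_pos h', append_of_pos, append_of_pos] <;> try (simp only; omega)
    ext1 <;> simp only <;> omega

/-- The minimum is attained in `s`, or in `t` shifted by the final depth `s.down + s.up` of `s`. The
test by which the walks locate a closing parenthesis rests on this. -/
theorem append_down {s t : Summary α} (hs : s.Valid) :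
    (s.append t).down = min s.down (s.down + s.up + t.down) := by
  have := hs.up_nonneg
  rcases lt_trichotomy (s.up + t.down) 0 with h | h | h
  · rw [append_of_neg h]; simp only; omega
  · rw [append_of_eq h]; simp only; omega
  · rw [append_of_pos h]; simp only; omega

/-- Multiplicativity: the summary of a stretch of the tour can be assembled from the stored
summaries of the search subtrees that make it up. -/
theorem ofList_append (val : α → ℕ) (l₁ l₂ : List (Paren α)) :
    ofList val (l₁ ++ l₂) = (ofList val l₁).append (ofList val l₂) := by
  induction l₁ with
  | nil => exact (empty_append (valid_ofList val l₂)).symm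
  | cons p l ih =>
    simp only [List.cons_append, ofList, ih]
    exact (append_assoc (valid_single val p) (valid_ofList val l) (valid_ofList val l₂)).symm

theorem ofList_append_down (val : α → ℕ) (l₁ l₂ : List (Paren α)) :
    (ofList val (l₁ ++ l₂)).down =
      min (ofList val l₁).down
        ((ofList val l₁).down + (ofList val l₁).up + (ofList val l₂).down) := by
  rw [ofList_append, append_down (valid_ofList val l₁)]

theorem ofList_singleton (val : α → ℕ) (p : Paren α) : ofList val [p] = single val p := by
  unfold ofList ofList single
  split
  · rw [append_of_pos (by simp [empty])]; simp [empty]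
  · rw [append_of_eq (by simp [empty])]; simp [empty]

theorem ofList_concat (val : α → ℕ) (l : List (Paren α)) (p : Paren α) :
    ofList val (l ++ [p]) = (ofList val l).append (single val p) := by
  rw [ofList_append, ofList_singleton]

end Summary

/-- The largest sum of values in a tree of a forest, 0 for the empty forest. -/
def OForest.maxTreeSum {α : Type*} (val : α → ℕ) : OForest α → ℕ
  | .nil => 0
  | .node a c s => max (val a + (c.nodes.map val).sum) (s.maxTreeSum val)

/-! ### Summaries of depth first tours -/

namespace Summary

variable {α : Type*}

theorem single_open (val : α → ℕ) (a : α) :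
    single val ⟨a, true⟩ = ⟨0, 1, none, 0, 0, 0, val a⟩ := rfl

theorem single_close (val : α → ℕ) (a : α) :
    single val ⟨a, false⟩ = ⟨-1, 0, some ⟨a, false⟩, 0, 0, 0, 0⟩ := rfl

/-- A tour is balanced, so prefix and suffix are empty. At a node, the opening parenthesis gathers
the values of its descendants in the suffix, the closing one turns them into one subtree of the
body, and the siblings extend the body. -/
theorem ofList_tour (val : α → ℕ) : ∀ f : OForest α,
    ∃ p, ofList val f.tour = ⟨0, 0, p, 0, (f.nodes.map val).sum, f.maxTreeSum val, 0⟩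
  | .nil => ⟨none, rfl⟩
  | .node a c s => by
    obtain ⟨p, hp⟩ := ofList_tour val c
    obtain ⟨q, hq⟩ := ofList_tour val s
    have e : (OForest.node a c s).tour = ((([⟨a, true⟩] ++ c.tour) ++ [⟨a, false⟩]) ++ s.tour) := by
      simp [OForest.tour]
    rw [e, ofList_append, ofList_concat, ofList_append, ofList_singleton, hp, hq, single_open,
      single_close, append_of_pos (s := ⟨0, 1, none, 0, 0, 0, val a⟩) (by simp),
      append_of_eq (t := ⟨-1, 0, some ⟨a, false⟩, 0, 0, 0, 0⟩) (by simp),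
      append_of_eq (by simp)]
    exact ⟨_, by simp [OForest.maxTreeSum, OForest.nodes, add_assoc]; rfl⟩

end Summary

namespace OForest

variable {α : Type*}

theorem foldl_add (x : ℕ) (l : List ℕ) : l.foldl (· + ·) x = x + l.sum := by
  induction l generalizing x with
  | nil => simp
  | cons y l ih => simp [ih, add_assoc]

theorem filterMap_reduce_treeNodes_node (val : α → ℕ) (a : α) (c s : OForest α) :
    (node a c s).treeNodes.filterMap (fun l => reduce (· + ·) (l.map val)) =
      (val a + (c.nodes.map val).sum) ::
        s.treeNodes.filterMap (fun l => reduce (· + ·) (l.map val)) := by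
  rw [treeNodes, List.filterMap_cons_some]
  simp [reduce, foldl_add]

theorem foldl_max_treeNodes (val : α → ℕ) (f : OForest α) (x : ℕ) :
    (f.treeNodes.filterMap (fun l => reduce (· + ·) (l.map val))).foldl max x =
      max x (f.maxTreeSum val) := by
  induction f generalizing x with
  | nil => simp [treeNodes, maxTreeSum]
  | node a c s _ ih =>
    rw [filterMap_reduce_treeNodes_node, List.foldl_cons, ih, maxTreeSum, max_assoc]

theorem maxsumChild_eq (f : OForest α) (val : α → ℕ) (v : α) :
    f.maxsumChild val v = (f.childSubtrees v).maxTreeSum val := by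
  unfold maxsumChild reduceChildSubtrees
  cases f.childSubtrees v with
  | nil => simp [treeNodes, reduce, maxTreeSum]
  | node a c s =>
    rw [filterMap_reduce_treeNodes_node, reduce, Option.getD_some, foldl_max_treeNodes,
      maxTreeSum]

/-- The part of a depth first tour that starts with the close-node of `v` leads up to the root. -/
theorem exists_tour_eq (val : α → ℕ) (v : α) : ∀ f : OForest α, v ∈ f.nodes →
    ∃ A B root, f.tour = A ++ ⟨v, true⟩ :: ((f.childSubtrees v).tour ++ ⟨v, false⟩ :: B) ∧
      f.rootOf v = some root ∧
      (Summary.ofList val (⟨v, false⟩ :: B)).up = 0 ∧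
      (Summary.ofList val (⟨v, false⟩ :: B)).first = some ⟨root, false⟩
  | .nil, h => by simp [nodes] at h
  | .node a c s, h => by
    -- Later trees in the same search tree are balanced and never go below the depth reached by `L`,
    -- so the leftmost minimum stays where it was.
    have key : ∀ (L : List (Paren α)) (p : Paren α), (Summary.ofList val L).up = 0 →
        (Summary.ofList val L).first = some p → (Summary.ofList val (L ++ s.tour)).up = 0 ∧
        (Summary.ofList val (L ++ s.tour)).first = some p := by
      intro L p h1 h2
      obtain ⟨q, hq⟩ := Summary.ofList_tour val s
      rw [Summary.ofList_append, hq, Summary.append_of_eq (by simp [h1])]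
      simp [h2]
    by_cases hva : v = a
    · subst hva
      refine ⟨[], s.tour, v, by simp [tour, childSubtrees], by simp [rootOf], ?_⟩
      refine key [⟨v, false⟩] _ ?_ ?_ <;> rw [Summary.ofList_singleton] <;> rfl
    by_cases hc : v ∈ c.nodes
    · obtain ⟨A, B, root, h1, h2, h3, h4⟩ := exists_tour_eq val v c hc
      refine ⟨⟨a, true⟩ :: A, (B ++ [⟨a, false⟩]) ++ s.tour, a, ?_, by simp [rootOf, hc], ?_⟩
      · simp [tour, childSubtrees, hva, hc, h1]
      -- The close-node of `a` lies strictly below all depths met so far, so it replaces the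
      -- candidate for the root found among the children.
      · have := key (⟨v, false⟩ :: B ++ [⟨a, false⟩]) ⟨a, false⟩
        rw [Summary.ofList_concat, Summary.append_of_neg (by simp [h3, Summary.single])] at this
        simpa using this rfl rfl
    · have hs : v ∈ s.nodes := by simpa [nodes, hva, hc] using h
      obtain ⟨A, B, root, h1, h2, h3, h4⟩ := exists_tour_eq val v s hs
      refine ⟨⟨a, true⟩ :: (c.tour ++ ⟨a, false⟩ :: A), B, root, ?_, ?_, h3, h4⟩
      · simp [tour, childSubtrees, hva, hc, h1]
      · simp [rootOf, hva, hc, h2]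

end OForest
end DFT

namespace DFT

/-! ### Evaluation of loop-free programs, and running times -/

namespace Prog

open Classical in
/-- The final registers of a loop-free program. -/
noncomputable def eval (h : Heap) : Prog → Regs → Regs
  | skip, s => s
  | const r z, s => Function.update s r z
  | copy r a, s => Function.update s r (s a)
  | add r a b, s => Function.update s r (s a + s b)
  | sub r a b, s => Function.update s r (s a - s b)
  | load r a f, s => Function.update s r (h (s a) f)
  | seq p q, s => q.eval h (p.eval h s)
  | ite c a b p q, s => if c.Holds (s a) (s b) then p.eval h s else q.eval h s
  | .while _ _ _ _, s => s

theorem eval_ite_pos {h : Heap} {c : Cmp} {a b : ℕ} {p q : Prog} {s : Regs}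
    (hc : c.Holds (s a) (s b)) : (ite c a b p q).eval h s = p.eval h s := by
  rw [eval, if_pos hc]

theorem eval_ite_neg {h : Heap} {c : Cmp} {a b : ℕ} {p q : Prog} {s : Regs}
    (hc : ¬ c.Holds (s a) (s b)) : (ite c a b p q).eval h s = q.eval h s := by
  rw [eval, if_neg hc]

/-- A bound for the number of steps of a loop-free program. -/
def cost : Prog → ℕ
  | skip => 0
  | seq p q => p.cost + q.cost
  | ite _ _ _ p q => p.cost + q.cost + 1
  | _ => 1

/-- There are no loops in a program. -/
def LoopFree : Prog → Prop
  | seq p q => p.LoopFree ∧ q.LoopFree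
  | ite _ _ _ p q => p.LoopFree ∧ q.LoopFree
  | .while _ _ _ _ => False
  | _ => True

/-- The registers that a program assigns to. -/
def writes : Prog → List ℕ
  | const r _ => [r]
  | copy r _ => [r]
  | add r _ _ => [r]
  | sub r _ _ => [r]
  | load r _ _ => [r]
  | seq p q => p.writes ++ q.writes
  | ite _ _ _ p q => p.writes ++ q.writes
  | _ => []

theorem eval_of_notMem_writes (h : Heap) {i : ℕ} (P : Prog) (s : Regs) (hi : i ∉ P.writes) :
    P.eval h s i = s i := by
  induction P generalizing s with
  | seq p q hp hq =>
    simp only [writes, List.mem_append, not_or] at hi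
    rw [eval, hq _ hi.2, hp _ hi.1]
  | ite c a b p q hp hq =>
    simp only [writes, List.mem_append, not_or] at hi
    rw [eval]
    split
    · exact hp _ hi.1
    · exact hq _ hi.2
  | _ => simp_all [writes, eval]

theorem exec_eval (h : Heap) : ∀ (P : Prog) (s : Regs), P.LoopFree →
    ∃ t ≤ P.cost, Exec h P s t (P.eval h s)
  | skip, s, _ => ⟨_, le_rfl, .skip s⟩
  | const r z, s, _ => ⟨_, le_rfl, .const s r z⟩
  | copy r a, s, _ => ⟨_, le_rfl, .copy s r a⟩
  | add r a b, s, _ => ⟨_, le_rfl, .add s r a b⟩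
  | sub r a b, s, _ => ⟨_, le_rfl, .sub s r a b⟩
  | load r a f, s, _ => ⟨_, le_rfl, .load s r a f⟩
  | seq p q, s, hl => by
    obtain ⟨t, ht, e⟩ := exec_eval h p s hl.1
    obtain ⟨t', ht', e'⟩ := exec_eval h q (p.eval h s) hl.2
    exact ⟨_, add_le_add ht ht', e.seq e'⟩
  | ite c a b p q, s, hl => by
    by_cases hc : c.Holds (s a) (s b)
    · obtain ⟨t, ht, e⟩ := exec_eval h p s hl.1
      exact ⟨t + 1, by simp only [cost]; omega, by rw [eval, if_pos hc]; exact .ite_true hc e⟩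
    · obtain ⟨t, ht, e⟩ := exec_eval h q s hl.2
      exact ⟨t + 1, by simp only [cost]; omega, by rw [eval, if_neg hc]; exact .ite_false hc e⟩

end Prog

/-- The program `P`, started with registers `s`, terminates within `n` steps, with registers
that satisfy `Q`. -/
def Runs (h : Heap) (P : Prog) (s : Regs) (n : ℕ) (Q : Regs → Prop) : Prop :=
  ∃ t s', Exec h P s t s' ∧ t ≤ n ∧ Q s'

namespace Runs

variable {h : Heap} {P P' : Prog} {s : Regs} {n m : ℕ} {Q R : Regs → Prop}

theorem mono (H : Runs h P s n Q) (hnm : n ≤ m) (hQR : ∀ s', Q s' → R s') : Runs h P s m R := by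
  obtain ⟨t, s', e, ht, hq⟩ := H
  exact ⟨t, s', e, ht.trans hnm, hQR _ hq⟩

theorem of_eval (hP : P.LoopFree) (hQ : Q (P.eval h s)) : Runs h P s P.cost Q := by
  obtain ⟨t, ht, e⟩ := P.exec_eval h s hP
  exact ⟨t, _, e, ht, hQ⟩

theorem seq (H : Runs h P s n fun s' => Runs h P' s' m Q) : Runs h (.seq P P') s (n + m) Q := by
  obtain ⟨t, s', e, ht, t', s'', e', ht', hq⟩ := H
  exact ⟨_, _, e.seq e', add_le_add ht ht', hq⟩

theorem eval_seq (hP : P.LoopFree) (H : Runs h P' (P.eval h s) n Q) :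
    Runs h (.seq P P') s (P.cost + n) Q :=
  seq (of_eval hP H)

theorem while_false {c : Cmp} {a b : ℕ} (hc : ¬ c.Holds (s a) (s b)) (hQ : Q s) :
    Runs h (.while c a b P) s 1 Q :=
  ⟨_, _, .while_false hc, le_rfl, hQ⟩

theorem while_true {c : Cmp} {a b : ℕ} (hP : P.LoopFree) (hc : c.Holds (s a) (s b))
    (H : Runs h (.while c a b P) (P.eval h s) n Q) :
    Runs h (.while c a b P) s (n + (P.cost + 1)) Q := by
  obtain ⟨t, ht, e⟩ := P.exec_eval h s hP
  obtain ⟨t', s', e', ht', hq⟩ := H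
  exact ⟨_, _, .while_true hc e e', by omega, hq⟩

end Runs

/-! ### Computing with summaries

Registers: 5 is the input of `segment`, 6 the address at which to stop (0 for none), 7 and 8 an
address and that of its parent, 9 a pending search tree, 10 to 15 the fields of the accumulated
summary, 20 to 26 the fields of the summary to be appended, 31 the constant 0. -/

namespace Prog

/-- Run a list of programs one after the other. -/
def block : List Prog → Prog
  | [] => skip
  | p :: l => seq p (block l)

/-- Load the summary stored in the record at the address in register 16. -/
def loadTree : Prog :=
  block [load 20 16 .down, load 21 16 .up, load 22 16 .first, load 23 16 .prefixSum,
    load 24 16 .bodySum, load 25 16 .bodyMax, load 26 16 .suffixSum]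

/-- Form the summary of the single entry at the address in register 16. -/
def loadParen : Prog :=
  block [const 20 0, const 21 0, const 22 0, const 23 0, const 24 0, const 25 0, const 26 0,
    load 18 16 .isOpen,
    ite .ne 18 31 (block [const 21 1, load 26 16 .val]) (block [const 20 (-1), copy 22 16])]

/-- Append the loaded summary to the accumulated summary. -/
def appendSummary : Prog :=
  -- Register 18 is the depth at the junction, whose sign selects the case of `Summary.append`. No
  -- other field depends on the accumulated `down`, so no register keeps it.
  seq (add 18 10 20) <|
  ite .lt 31 18
    (block [add 10 18 21, add 15 15 23, add 15 15 24, add 15 15 26]) <|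
  ite .eq 18 31
    (block [copy 10 21, ite .eq 11 31 (copy 11 22) skip, add 18 15 23, add 13 13 18, add 13 13 24,
      ite .lt 14 18 (copy 14 18) skip, ite .lt 14 25 (copy 14 25) skip, copy 15 26])
    (block [copy 10 21, copy 11 22, add 12 12 13, add 12 12 15, add 12 12 23, copy 13 24,
      copy 14 25, copy 15 26])

/-- Append the summary of the search tree in register 16. -/
def appendTree : Prog := seq loadTree appendSummary

/-- Append the summary of the entry in register 16. -/
def appendParen : Prog := seq loadParen appendSummary

end Prog

/-! ### Correctness of the summary registers -/

section Specs

variable {α : Type*} {addr : Paren α → ℤ} {h : Heap} {val : α → ℕ}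

/-- The accumulated summary. -/
structure Acc (addr : Paren α → ℤ) (s : Regs) (σ : Summary α) : Prop where
  up : s 10 = σ.up
  first : s 11 = optPtr addr σ.first
  prefixSum : s 12 = σ.prefixSum
  bodySum : s 13 = σ.bodySum
  bodyMax : s 14 = σ.bodyMax
  suffixSum : s 15 = σ.suffixSum

/-- The loaded summary. -/
structure Loaded (addr : Paren α → ℤ) (s : Regs) (σ : Summary α) : Prop where
  down : s 20 = σ.down
  up : s 21 = σ.up
  first : s 22 = optPtr addr σ.first
  prefixSum : s 23 = σ.prefixSum
  bodySum : s 24 = σ.bodySum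
  bodyMax : s 25 = σ.bodyMax
  suffixSum : s 26 = σ.suffixSum

/-- The registers `0, …, k - 1` and 31 are unchanged. -/
def Frame (k : ℕ) (s s' : Regs) : Prop := (∀ i < k, s' i = s i) ∧ s' 31 = s 31

theorem Frame.trans {k : ℕ} {s s' s'' : Regs} (h₁ : Frame k s s') (h₂ : Frame k s' s'') :
    Frame k s s'' :=
  ⟨fun i hi => (h₂.1 i hi).trans (h₁.1 i hi), h₂.2.trans h₁.2⟩

theorem Frame.mono {k l : ℕ} {s s' : Regs} (h₁ : Frame k s s') (hl : l ≤ k) : Frame l s s' :=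
  ⟨fun i hi => h₁.1 i (hi.trans_le hl), h₁.2⟩

/-- The hypothesis concerns a finite list of register numbers, so for a concrete program it is
settled by `decide`. -/
theorem frame_eval (h : Heap) {k : ℕ} {P : Prog} (hP : ∀ r ∈ P.writes, k ≤ r ∧ r ≠ 31)
    (s : Regs) : Frame k s (P.eval h s) :=
  ⟨fun i hi => P.eval_of_notMem_writes h s fun hr => absurd (hP i hr).1 (by omega),
    P.eval_of_notMem_writes h s fun hr => (hP 31 hr).2 rfl⟩

theorem optPtr_eq_zero (h0 : ∀ p, addr p ≠ 0) (o : Option (Paren α)) :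
    optPtr addr o = 0 ↔ o = none := by
  cases o <;> simp [optPtr, h0]

open Prog
open Function (update update_of_ne)

theorem eval_loadTree {par : ℤ} {t : BinaryTree (Paren α)} (ht : StoredTree val addr h par t)
    (hne : t ≠ .nil) {s : Regs} (h16 : s 16 = rootPtr addr t) :
    Loaded addr (loadTree.eval h s) (Summary.ofList val (inorder t)) := by
  cases t with
  | nil => exact absurd rfl hne
  | node q l r =>
    simp only [StoredTree] at ht
    obtain ⟨-, -, -, -, -, -, h1, h2, h3, h4, h5, h6, h7, -⟩ := ht
    simp only [rootPtr] at h16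
    constructor <;> simp [loadTree, block, eval, update, *]

theorem eval_loadParen {p : Paren α} (h1 : h (addr p) .isOpen = if p.isOpen then 1 else 0)
    (h2 : h (addr p) .val = val p.node) {s : Regs} (h16 : s 16 = addr p) (h31 : s 31 = 0) :
    Loaded addr (loadParen.eval h s) (Summary.single val p) := by
  cases ho : p.isOpen <;> constructor <;>
    simp [loadParen, block, eval, update, Cmp.Holds, Summary.single, optPtr, *]

theorem eval_appendSummary (h0 : ∀ p, addr p ≠ 0) {σ τ : Summary α} {s : Regs}
    (hσ : Acc addr s σ) (hτ : Loaded addr s τ) (h31 : s 31 = 0) :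
    Acc addr (appendSummary.eval h s) (σ.append τ) := by
  obtain ⟨a1, a2, a3, a4, a5, a6⟩ := hσ
  obtain ⟨b1, b2, b3, b4, b5, b6, b7⟩ := hτ
  rcases lt_trichotomy (σ.up + τ.down) 0 with hc | hc | hc
  · rw [Summary.append_of_neg hc]
    have c1 : ¬ (0 < σ.up + τ.down) := by omega
    have c2 : ¬ (σ.up + τ.down = 0) := by omega
    constructor <;> simp [appendSummary, block, eval, update, Cmp.Holds, *]
  · rw [Summary.append_of_eq hc]
    have c1 : (Option.or σ.first τ.first) = if σ.first = none then τ.first else σ.first := by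
      cases σ.first <;> simp
    -- These cases are the outcomes of the null test that implements `Option.or` and of the
    -- comparisons that implement the two maxima.
    by_cases d0 : σ.first = none <;>
    by_cases d1 : (σ.bodyMax : ℤ) < σ.suffixSum + τ.prefixSum <;>
    by_cases d2 : (σ.bodyMax : ℤ) < τ.bodyMax <;>
    by_cases d3 : (σ.suffixSum + τ.prefixSum : ℤ) < τ.bodyMax <;>
    constructor <;>
    simp [appendSummary, block, eval, update, Cmp.Holds, optPtr_eq_zero h0, *] <;> omega
  · rw [Summary.append_of_pos hc]
    constructor <;> simp [appendSummary, block, eval, update, Cmp.Holds, *]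

end Specs
end DFT

namespace DFT

/-! ### Walking through a search tree -/

namespace Prog

/-- Append the search tree in register 9, and clear the register. -/
def appendPending : Prog := block [copy 16 9, appendTree, copy 9 31]

/-- Proceed past the right search subtree of the entry in register 8, and up to its parent. Stop
if a search is under way and the sought entry lies in this subtree. -/
def advance : Prog :=
  seq (block [load 9 8 .right, copy 7 8, load 8 8 .parent]) <|
  ite .ne 9 31
    (seq (block [load 17 9 .down, add 17 10 17])
      (ite .lt 17 31 (ite .ne 6 31 (copy 8 6) appendPending) appendPending))
    skip

/-- One step upwards. -/
def climbBody : Prog :=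
  seq (load 17 8 .left)
    (ite .eq 17 7 (seq (seq (copy 16 8) appendParen) advance) (block [copy 7 8, load 8 8 .parent]))

/-- Go upwards until the entry in register 6 is met, or lies in the right search subtree of the
current entry. -/
def climb : Prog := .while .ne 8 6 climbBody

/-- One step downwards. -/
def descendBody : Prog :=
  seq (block [load 16 9 .left, copy 17 10,
    ite .ne 16 31 (block [load 18 16 .down, add 17 10 18]) skip]) <|
  ite .lt 17 31 (copy 9 16) <|
  seq (ite .ne 16 31 appendTree skip) <|
  ite .eq 9 6 (copy 9 31) (seq (seq (copy 16 9) appendParen) (load 9 9 .right))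

/-- Go down from the entry in register 9 to the entry in register 6. -/
def descend : Prog := .while .ne 9 31 descendBody

end Prog

section Walk

variable {α : Type*} {addr : Paren α → ℤ} {h : Heap} {val : α → ℕ}

open Prog Summary
open Function (update update_of_ne)

theorem Acc.congr {s s' : Regs} {σ : Summary α} (hs : Acc addr s σ) (hf : Frame 16 s s') :
    Acc addr s' σ := by
  obtain ⟨a1, a2, a3, a4, a5, a6⟩ := hs
  constructor <;> rw [hf.1 _ (by norm_num)] <;> assumption

theorem Acc.update {s : Regs} {σ : Summary α} (hs : Acc addr s σ) {r : ℕ}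
    (hr : r < 10 ∨ 15 < r) (z : ℤ) : Acc addr (update s r z) σ := by
  obtain ⟨a1, a2, a3, a4, a5, a6⟩ := hs
  constructor <;> rw [update_of_ne (by omega)] <;> assumption

theorem Acc.eval {s : Regs} {σ : Summary α} (hs : Acc addr s σ) {P : Prog}
    (hP : ∀ r ∈ P.writes, r < 10 ∨ 15 < r) : Acc addr (P.eval h s) σ := by
  have key : ∀ i, 10 ≤ i → i ≤ 15 → P.eval h s i = s i := fun i h1 h2 =>
    P.eval_of_notMem_writes h s fun hr => by have := hP i hr; omega
  obtain ⟨a1, a2, a3, a4, a5, a6⟩ := hs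
  constructor <;> rw [key _ (by norm_num) (by norm_num)] <;> assumption

theorem eval_appendTree (h0 : ∀ p, addr p ≠ 0) {par : ℤ} {t : BinaryTree (Paren α)}
    (ht : StoredTree val addr h par t) (hne : t ≠ .nil) {s : Regs} (h16 : s 16 = rootPtr addr t)
    (h31 : s 31 = 0) {L : List (Paren α)} (hL : Acc addr s (ofList val L)) :
    Acc addr (appendTree.eval h s) (ofList val (L ++ inorder t)) := by
  have hf : Frame 16 s (loadTree.eval h s) := frame_eval h (by decide) s
  rw [ofList_append]
  exact eval_appendSummary h0 (hL.congr hf) (eval_loadTree ht hne h16) (hf.2.trans h31)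

theorem eval_appendParen (h0 : ∀ p, addr p ≠ 0) {par : ℤ} {p : Paren α}
    {l r : BinaryTree (Paren α)} (ht : StoredTree val addr h par (.node p l r)) {s : Regs}
    (h16 : s 16 = addr p) (h31 : s 31 = 0) {L : List (Paren α)}
    (hL : Acc addr s (ofList val L)) :
    Acc addr (appendParen.eval h s) (ofList val (L ++ [p])) := by
  simp only [StoredTree] at ht
  have hf : Frame 16 s (loadParen.eval h s) := frame_eval h (by decide) s
  rw [ofList_concat]
  exact eval_appendSummary h0 (hL.congr hf)
    (eval_loadParen ht.2.2.2.2.1 ht.2.2.2.2.2.1 h16 h31) (hf.2.trans h31)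

theorem rootPtr_ne_zero (h0 : ∀ p, addr p ≠ 0) {t : BinaryTree (Paren α)} (ht : t ≠ .nil) :
    rootPtr addr t ≠ 0 := by
  cases t with
  | nil => exact absurd rfl ht
  | node q l r => exact h0 q

theorem StoredTree.down {par : ℤ} {t : BinaryTree (Paren α)} (ht : StoredTree val addr h par t)
    (hne : t ≠ .nil) : h (rootPtr addr t) .down = (ofList val (inorder t)).down := by
  cases t with
  | nil => exact absurd rfl hne
  | node q l r => exact ht.2.2.2.2.2.2.1

theorem frame_advance (s : Regs) : Frame 7 s (advance.eval h s) := frame_eval h (by decide) s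

/-- The condition on depths says that the right subtree does not go below the starting level, hence
does not hold the sought entry. It is void when register 6 is 0, that is, when nothing is sought. -/
theorem eval_advance (h0 : ∀ p, addr p ≠ 0) {par : ℤ} {q : Paren α}
    {l r : BinaryTree (Paren α)} (ht : StoredTree val addr h par (.node q l r)) {s : Regs}
    (h8 : s 8 = addr q) (h31 : s 31 = 0) {L : List (Paren α)} (hL : Acc addr s (ofList val L))
    (hd : s 6 ≠ 0 → 0 ≤ (ofList val L).up + (ofList val (inorder r)).down) :
    advance.eval h s 7 = addr q ∧ advance.eval h s 8 = par ∧ advance.eval h s 9 = 0 ∧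
      Acc addr (advance.eval h s) (ofList val (L ++ inorder r)) := by
  simp only [StoredTree] at ht
  obtain ⟨-, e1, e2, -, -, -, -, -, -, -, -, -, -, -, hr⟩ := ht
  rw [advance, eval]
  set s₁ := (block [load 9 8 .right, copy 7 8, load 8 8 .parent]).eval h s with hs₁
  have a7 : s₁ 7 = addr q := by simp [hs₁, block, eval, update, h8]
  have a8 : s₁ 8 = par := by simp [hs₁, block, eval, update, h8, e2]
  have a9 : s₁ 9 = rootPtr addr r := by simp [hs₁, block, eval, update, h8, e1]
  have a31 : s₁ 31 = 0 := by simp [hs₁, block, eval, update, h31]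
  have a6 : s₁ 6 = s 6 := by simp [hs₁, block, eval, update]
  have aL : Acc addr s₁ (ofList val L) := hL.eval (by decide)
  clear_value s₁
  by_cases hne : r = .nil
  · subst hne
    simp only [rootPtr] at a9
    simp [eval, Cmp.Holds, a9, a31, a7, a8, inorder, aL]
  · rw [eval, if_pos (by rw [Cmp.Holds, a9, a31]; exact rootPtr_ne_zero h0 hne), eval]
    set s₂ := (block [load 17 9 .down, add 17 10 17]).eval h s₁ with hs₂
    have hf₂ : Frame 16 s₁ s₂ := frame_eval h (by decide) s₁
    have b17 : s₂ 17 = (ofList val L).up + (ofList val (inorder r)).down := by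
      simp [hs₂, block, eval, update, a9, hr.down hne, aL.up]
    clear_value s₂
    -- A negative test with a nonzero target is excluded by `hd`, so every surviving branch appends
    -- the subtree.
    have key : ((Prog.ite .lt 17 31 (.ite .ne 6 31 (copy 8 6) appendPending)
        appendPending).eval h s₂) = appendPending.eval h s₂ := by
      rw [eval]
      split_ifs with hc
      · rw [eval, if_neg]
        intro h6
        simp only [Cmp.Holds, b17, hf₂.2, a31, hf₂.1 6 (by norm_num), a6] at hc h6
        exact absurd (hd h6) (by omega)
      · rfl
    rw [key]
    have hp : appendPending.eval h s₂ =
        update (appendTree.eval h (update s₂ 16 (s₂ 9))) 9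
          (appendTree.eval h (update s₂ 16 (s₂ 9)) 31) := rfl
    have hf₃ : Frame 10 s₂ (appendTree.eval h (update s₂ 16 (s₂ 9))) :=
      frame_eval h (P := .seq (copy 16 9) appendTree) (by decide) s₂
    have hL₃ := eval_appendTree h0 hr hne (s := update s₂ 16 (s₂ 9)) (L := L)
      (by simp [hf₂.1 9 (by norm_num), a9]) (by simp [update, hf₂.2, a31]) ((aL.congr hf₂).update (by norm_num) _)
    rw [hp]
    set s₃ := appendTree.eval h (update s₂ 16 (s₂ 9))
    clear_value s₃
    refine ⟨?_, ?_, ?_, ?_⟩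
    · simp [update, hf₃.1 7 (by norm_num), hf₂.1 7 (by norm_num), a7]
    · simp [update, hf₃.1 8 (by norm_num), hf₂.1 8 (by norm_num), a8]
    · simp [hf₃.2, hf₂.2, a31]
    · exact hL₃.update (by norm_num) _

/-- The depth falls below the starting level inside the right subtree, so the sought entry is there.
The subtree stays pending in register 9, and register 8 is set to the target to end the climb. -/
theorem eval_advance_stop (h0 : ∀ p, addr p ≠ 0) {par : ℤ} {q : Paren α}
    {l r : BinaryTree (Paren α)} (ht : StoredTree val addr h par (.node q l r)) {s : Regs}
    (h8 : s 8 = addr q) (h31 : s 31 = 0) {L : List (Paren α)} (hL : Acc addr s (ofList val L))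
    (h6 : s 6 ≠ 0) (hd : (ofList val L).up + (ofList val (inorder r)).down < 0) :
    advance.eval h s 8 = s 6 ∧ advance.eval h s 9 = rootPtr addr r ∧
      Acc addr (advance.eval h s) (ofList val L) := by
  -- An empty subtree has `down = 0`, and the accumulated `up` is nonnegative.
  have hne : r ≠ .nil := by
    rintro rfl
    have := (valid_ofList val L).up_nonneg
    simp [inorder, ofList, Summary.empty] at hd
    omega
  simp only [StoredTree] at ht
  obtain ⟨-, e1, e2, -, -, -, -, -, -, -, -, -, -, -, hr⟩ := ht
  have e3 := hr.down hne
  have e4 := rootPtr_ne_zero h0 hne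
  obtain ⟨b1, b2, b3, b4, b5, b6⟩ := hL
  refine ⟨?_, ?_, ?_⟩
  · simp [advance, block, eval, update, Cmp.Holds, *]
  · simp [advance, block, eval, update, Cmp.Holds, *]
  · constructor <;> simp [advance, block, eval, update, Cmp.Holds, *]

/-- When the walk arrives from the left child, the entry `q` and then its right subtree come next in
the tour. -/
theorem eval_climbBody_left (h0 : ∀ p, addr p ≠ 0) {par : ℤ} {q : Paren α}
    {l r : BinaryTree (Paren α)} (ht : StoredTree val addr h par (.node q l r)) {s : Regs}
    (h7 : s 7 = rootPtr addr l) (h8 : s 8 = addr q) (h31 : s 31 = 0) {L : List (Paren α)}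
    (hL : Acc addr s (ofList val L)) :
    ∃ s₁, climbBody.eval h s = advance.eval h s₁ ∧ Frame 10 s s₁ ∧
      Acc addr s₁ (ofList val (L ++ [q])) := by
  refine ⟨appendParen.eval h (update (update s 17 (h (s 8) .left)) 16 (s 8)), ?_, ?_, ?_⟩
  · have e := ht.1
    rw [climbBody, eval, eval, eval, if_pos (by simp [Cmp.Holds, update, h8, h7, e])]
    simp [eval, update]
  · exact frame_eval h (P := .seq (load 17 8 .left) (.seq (copy 16 8) appendParen))
      (by decide) s
  · refine eval_appendParen h0 ht (by simp [h8]) (by simp [update, h31]) ?_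
    exact (hL.update (by norm_num) _).update (by norm_num) _

/-- When the walk arrives from the right child, everything in this subtree has already been passed
or precedes the start, so nothing is appended. -/
theorem eval_climbBody_right {par : ℤ} {q : Paren α}
    {l r : BinaryTree (Paren α)} (ht : StoredTree val addr h par (.node q l r)) {s : Regs}
    (h7 : s 7 ≠ rootPtr addr l) (h8 : s 8 = addr q) {σ : Summary α} (hL : Acc addr s σ) :
    climbBody.eval h s 7 = addr q ∧ climbBody.eval h s 8 = par ∧ climbBody.eval h s 9 = s 9 ∧
      Acc addr (climbBody.eval h s) σ ∧ Frame 7 s (climbBody.eval h s) := by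
  have e := ht.1
  have e' := ht.2.2.1
  have e7 : rootPtr addr l ≠ s 7 := h7.symm
  obtain ⟨b1, b2, b3, b4, b5, b6⟩ := hL
  refine ⟨?_, ?_, ?_, ?_, frame_eval h (by decide) s⟩
  · simp [climbBody, block, eval, update, Cmp.Holds, *]
  · simp [climbBody, block, eval, update, Cmp.Holds, *]
  · simp [climbBody, block, eval, update, Cmp.Holds, *]
  · constructor <;> simp [climbBody, block, eval, update, Cmp.Holds, *]

/-! ### The loops -/

/-- Depths along the walk stay nonnegative up to the sought entry. The second part is the program's
test on a subtree `Y` lying before that entry; the next lemma gives the opposite outcome for a `Y`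
that contains it. -/
theorem ofList_append_down_eq_zero {X Y : List (Paren α)} (hd : (ofList val (X ++ Y)).down = 0) :
    (ofList val X).down = 0 ∧ 0 ≤ (ofList val X).up + (ofList val Y).down := by
  rw [ofList_append_down] at hd
  have := (valid_ofList val X).down_nonpos
  omega

theorem ofList_append_down_neg {X Y : List (Paren α)} (hX : (ofList val X).down = 0)
    (hd : (ofList val (X ++ Y)).down < 0) : (ofList val X).up + (ofList val Y).down < 0 := by
  rw [ofList_append_down] at hd
  omega

theorem ofList_append_down_le (X Y : List (Paren α)) :
    (ofList val (X ++ Y)).down ≤ (ofList val X).down := by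
  rw [ofList_append_down]
  omega

/-- `After t p B`: the entries of the search tree `t` after an occurrence of `p` are `B`. -/
inductive After {β : Type*} : BinaryTree β → β → List β → Prop
  | root (q : β) (l r : BinaryTree β) : After (.node q l r) q (inorder r)
  | left {q p : β} {l r : BinaryTree β} {B : List β} (hl : After l p B) :
      After (.node q l r) p (B ++ q :: inorder r)
  | right {q p : β} {l r : BinaryTree β} {B : List β} (hr : After r p B) :
      After (.node q l r) p B

/-- Two marked positions in one list: `p` comes before `q`, coincides with it, or comes after it.
For an inorder list these are the left subtree, the root and the right subtree. -/
theorem append_cons_eq_append_cons {β : Type*} {X Y A B : List β} {q p : β}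
    (he : X ++ q :: Y = A ++ p :: B) :
    (∃ X', X = A ++ p :: X' ∧ B = X' ++ q :: Y) ∨ (X = A ∧ q = p ∧ Y = B) ∨
      ∃ Y', A = X ++ q :: Y' ∧ Y = Y' ++ p :: B := by
  rcases List.append_eq_append_iff.1 he with ⟨Z, h1, h2⟩ | ⟨Z, h1, h2⟩
  · cases Z with
    | nil => simp_all
    | cons z Z => simp_all
  · cases Z with
    | nil => simp_all
    | cons z Z => simp_all

theorem After.of_inorder_eq {β : Type*} {p : β} : ∀ {t : BinaryTree β} {A B : List β},
    inorder t = A ++ p :: B → After t p B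
  | .nil, A, B, he => by simp [inorder] at he
  | .node q l r, A, B, he => by
    rcases append_cons_eq_append_cons he with ⟨X, h1, rfl⟩ | ⟨-, rfl, rfl⟩ | ⟨Y, -, h2⟩
    · exact .left (of_inorder_eq h1)
    · exact .root _ _ _
    · exact .right (of_inorder_eq h2)

theorem After.mem {β : Type*} {t : BinaryTree β} {p : β} {B : List β} (ha : After t p B) :
    p ∈ inorder t := by
  induction ha <;> simp [inorder, *]

/-- A climb recognises the side it comes from by comparing its previous address with the left child
pointer. This excludes a false match from the right, also when the left subtree is empty and its
pointer null. -/
theorem rootPtr_ne (hinj : Function.Injective addr) (h0 : ∀ p, addr p ≠ 0) {p : Paren α}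
    {l r : BinaryTree (Paren α)} (hn : (inorder l ++ p :: inorder r).Nodup) {p' : Paren α}
    (hr : p' ∈ inorder r) : rootPtr addr r ≠ rootPtr addr l := by
  cases r with
  | nil => simp [inorder] at hr
  | node a r₁ r₂ =>
    cases l with
    | nil => exact h0 _
    | node b l₁ l₂ =>
      intro he
      have := hinj he
      subst this
      exact (List.nodup_append.1 hn).2.2 a (by simp [inorder]) a (by simp [inorder]) rfl

/-- The walk leaves a search tree that does not contain the sought entry. -/
theorem climb_through (hinj : Function.Injective addr) (h0 : ∀ p, addr p ≠ 0)
    {t : BinaryTree (Paren α)} {p : Paren α} {B : List (Paren α)} (ha : After t p B) :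
    ∀ {par : ℤ}, StoredTree val addr h par t → (inorder t).Nodup →
    ∀ {s : Regs} {L : List (Paren α)}, s 8 = addr p → s 31 = 0 → Acc addr s (ofList val L) →
    (∀ q ∈ inorder t, addr q ≠ s 6) → (s 6 ≠ 0 → (ofList val (L ++ B)).down = 0) →
    ∀ {n : ℕ} {Q : Regs → Prop},
    (∀ s', Frame 7 s s' → s' 7 = rootPtr addr t → s' 8 = par → s' 9 = 0 →
      Acc addr s' (ofList val (L ++ B)) → Runs h climb s' n Q) →
    Runs h climb (advance.eval h s) (n + (climbBody.cost + 1) * t.height) Q := by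
  induction ha with
  | root q l r =>
    intro par ht hn s L h8 h31 hL hW hd n Q H
    obtain ⟨e7, e8, e9, eL⟩ := eval_advance h0 ht h8 h31 hL
      fun h6 => (ofList_append_down_eq_zero (hd h6)).2
    exact (H _ (frame_advance s) e7 e8 e9 eL).mono (by omega) fun _ hq => hq
  | @left q p l r B hl ih =>
    intro par ht hn s L h8 h31 hL hW hd n Q H
    have ht' := ht
    simp only [StoredTree] at ht
    obtain ⟨-, -, -, -, -, -, -, -, -, -, -, -, -, hsl, -⟩ := ht
    simp only [inorder, List.mem_append, List.mem_cons] at hW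
    have hd' : s 6 ≠ 0 → (ofList val (((L ++ B) ++ [q]) ++ inorder r)).down = 0 := by
      simpa using hd
    -- The additional `climbBody.cost + 1` pays for the iteration at `q`, which corresponds to the
    -- one extra level of height.
    refine (ih hsl (List.nodup_append.1 hn).1 h8 h31 hL (fun x hx => hW x (.inl hx))
      (fun h6 => (ofList_append_down_eq_zero (ofList_append_down_eq_zero (hd' h6)).1).1)
      (n := n + (climbBody.cost + 1)) (Q := Q) ?_).mono ?_ fun _ hq => hq
    · intro s' hf e7 e8 e9 eL
      obtain ⟨s₁, hs₁, hf₁, hL₁⟩ :=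
        eval_climbBody_left h0 ht' e7 e8 (hf.2.trans h31) eL
      have h6 : s₁ 6 = s 6 := (hf₁.1 6 (by norm_num)).trans (hf.1 6 (by norm_num))
      refine Runs.while_true (by simp [LoopFree, climbBody, block, appendParen, loadParen,
        appendSummary, advance, appendPending, appendTree, loadTree]) ?_ ?_
      · simp only [Cmp.Holds]
        rw [e8, hf.1 6 (by norm_num)]
        exact hW q (.inr (.inl rfl))
      · rw [hs₁]
        obtain ⟨f7, f8, f9, fL⟩ := eval_advance h0 ht'
          ((hf₁.1 8 (by norm_num)).trans e8) (hf₁.2.trans (hf.2.trans h31)) hL₁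
          fun h6' => (ofList_append_down_eq_zero (hd' (h6 ▸ h6'))).2
        exact H _ (hf.trans ((hf₁.mono (by norm_num)).trans (frame_advance s₁))) f7 f8 f9
          (by simpa using fL)
    · have : l.height + 1 ≤ (BinaryTree.node q l r).height := by
        simp [BinaryTree.height]
      nlinarith
  | @right q p l r B hr ih =>
    intro par ht hn s L h8 h31 hL hW hd n Q H
    have ht' := ht
    simp only [StoredTree] at ht
    obtain ⟨-, -, -, -, -, -, -, -, -, -, -, -, -, -, hsr⟩ := ht
    simp only [inorder, List.mem_append, List.mem_cons] at hW
    refine (ih hsr (List.nodup_append.1 hn).2.1.of_cons h8 h31 hL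
      (fun x hx => hW x (.inr (.inr hx))) hd
      (n := n + (climbBody.cost + 1)) (Q := Q) ?_).mono ?_ fun _ hq => hq
    · intro s' hf e7 e8 e9 eL
      obtain ⟨f7, f8, f9, fL, ff⟩ := eval_climbBody_right ht'
        (e7.trans_ne (rootPtr_ne hinj h0 hn hr.mem)) e8 eL
      refine Runs.while_true (by simp [LoopFree, climbBody, block, appendParen, loadParen,
        appendSummary, advance, appendPending, appendTree, loadTree]) ?_ ?_
      · simp only [Cmp.Holds]
        rw [e8, hf.1 6 (by norm_num)]
        exact hW q (.inr (.inl rfl))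
      · exact H _ (hf.trans ff) f7 f8 (f9.trans e9) fL
    · have : r.height + 1 ≤ (BinaryTree.node q l r).height := by
        simp [BinaryTree.height]
      nlinarith

end Walk
end DFT

namespace DFT

/-! ### Finding a closing parenthesis by climbing and descending -/

section Segment

variable {α : Type*} {addr : Paren α → ℤ} {h : Heap} {val : α → ℕ}

open Prog Summary
open Function (update update_of_ne)

theorem loopFree_climbBody : climbBody.LoopFree := by
  simp [LoopFree, climbBody, block, appendParen, loadParen, appendSummary, advance,
    appendPending, appendTree, loadTree]

theorem loopFree_descendBody : descendBody.LoopFree := by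
  simp [LoopFree, descendBody, block, appendParen, loadParen, appendSummary, appendTree, loadTree]

/-- The final states of a walk that looks for `q`, starts with the accumulated sequence `L`, and
has to pass the sequence `B` before it meets `q`. -/
def Found (val : α → ℕ) (addr : Paren α → ℤ) (h : Heap) (k : ℕ) (q : Paren α)
    (L B : List (Paren α)) (s : Regs) : Prop :=
  (s 9 = 0 ∧ Acc addr s (ofList val (L ++ B))) ∨
    ∃ par t L' B' C, StoredTree val addr h par t ∧ (inorder t).Nodup ∧ t.height ≤ k ∧
      inorder t = B' ++ q :: C ∧ L ++ B = L' ++ B' ∧ s 9 = rootPtr addr t ∧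
      Acc addr s (ofList val L')

theorem Found.mono {k l : ℕ} (hkl : k ≤ l) {q : Paren α} {L B : List (Paren α)} {s : Regs}
    (hf : Found val addr h k q L B s) : Found val addr h l q L B s :=
  hf.imp_right fun ⟨par, t, L', B', C, h1, h2, h3, h4⟩ =>
    ⟨par, t, L', B', C, h1, h2, h3.trans hkl, h4⟩

theorem ne_of_nodup_append_cons {β : Type*} {q : β} {X Y : List β} (hn : (X ++ q :: Y).Nodup) :
    ∀ x, x ∈ X ∨ x ∈ Y → x ≠ q := by
  rintro x (hx | hx) rfl
  · exact (List.nodup_append.1 hn).2.2 x hx x (by simp) rfl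
  · exact (List.nodup_cons.1 (List.nodup_append.1 hn).2.1).1 hx

/-- The walk upwards ends where the sought entry has been met or lies in a pending subtree. -/
theorem climb_found (hinj : Function.Injective addr) (h0 : ∀ p, addr p ≠ 0)
    {t : BinaryTree (Paren α)} {p q : Paren α} {A : List (Paren α)} (ha : After t p A) :
    ∀ {par : ℤ}, StoredTree val addr h par t → (inorder t).Nodup →
    ∀ {s : Regs} {L B C : List (Paren α)}, A = B ++ q :: C →
    s 8 = addr p → s 31 = 0 → Acc addr s (ofList val L) →
    s 6 = addr q → (ofList val (L ++ B)).down = 0 → (ofList val ((L ++ B) ++ [q])).down < 0 →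
    Runs h climb (advance.eval h s) ((climbBody.cost + 1) * t.height + 1)
      fun s' => Frame 7 s s' ∧ Found val addr h t.height q L B s' := by
  induction ha with
  | root x l r =>
    intro par ht hn s L B C hA h8 h31 hL h6 hd hq
    have ht' := ht
    simp only [StoredTree] at ht
    obtain ⟨-, -, -, -, -, -, -, -, -, -, -, -, -, -, hsr⟩ := ht
    -- `down` can only decrease when a sequence is extended, so the drop at the sought entry shows
    -- in the summary of the whole right subtree.
    have hneg : (ofList val L).up + (ofList val (inorder r)).down < 0 := by
      refine ofList_append_down_neg (ofList_append_down_eq_zero hd).1 ?_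
      refine lt_of_le_of_lt ?_ hq
      have := ofList_append_down_le (val := val) ((L ++ B) ++ [q]) C
      simpa [hA] using this
    obtain ⟨e8, e9, eL⟩ := eval_advance_stop h0 ht' h8 h31 hL (by rw [h6]; exact h0 q) hneg
    refine (Runs.while_false ?_ ⟨frame_advance s, .inr ⟨_, r, L, B, C, hsr,
      (List.nodup_append.1 hn).2.1.of_cons, ?_, hA, rfl, e9, eL⟩⟩).mono (by omega) fun _ hq => hq
    · simp only [Cmp.Holds, e8, (frame_advance s).1 6 (by norm_num)]
      simp
    · simp [BinaryTree.height]
      omega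
  | @left x p l r A hl ih =>
    intro par ht hn s L B C hA h8 h31 hL h6 hd hq
    have ht' := ht
    simp only [StoredTree] at ht
    obtain ⟨-, -, -, -, -, -, -, -, -, -, -, -, -, hsl, -⟩ := ht
    have hh : l.height + 1 ≤ (BinaryTree.node x l r).height := by simp [BinaryTree.height]
    have hnl := (List.nodup_append.1 hn).1
    -- The sought entry is in the rest of `l`, is `x` itself, or is in `r`. In the last two cases
    -- the walk leaves `l` by `climb_through`; it then stops by meeting `x`, or after one more
    -- iteration with `r` pending.
    rcases append_cons_eq_append_cons hA with ⟨X, h1, rfl⟩ | ⟨h1, h2, h3⟩ | ⟨Y, h1, h2⟩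
    · refine (ih hsl hnl h1 h8 h31 hL h6 hd hq).mono (by nlinarith) fun s' hs' => ?_
      exact ⟨hs'.1, hs'.2.mono (by omega)⟩
    · subst h1 h2
      refine (climb_through hinj h0 hl hsl hnl h8 h31 hL ?_ (fun _ => hd) (n := 1)
        (fun s' hf e7 e8 e9 eL => ?_)).mono (by nlinarith) fun _ hq => hq
      · intro y hy he
        exact ne_of_nodup_append_cons hn y (.inl hy) (hinj (he.trans h6))
      · refine Runs.while_false ?_ ⟨hf, .inl ⟨e9, eL⟩⟩
        simp only [Cmp.Holds, e8, hf.1 6 (by norm_num), h6]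
        simp
    · have hqr : q ∈ inorder r := by simp [h2]
      have hd' : (ofList val (((L ++ A) ++ [x]) ++ Y)).down = 0 := by simpa [h1] using hd
      have hdx := (ofList_append_down_eq_zero hd').1
      refine (climb_through hinj h0 hl hsl hnl h8 h31 hL ?_
        (fun _ => (ofList_append_down_eq_zero hdx).1) (n := 1 + (climbBody.cost + 1))
        (fun s' hf e7 e8 e9 eL => ?_)).mono (by nlinarith) fun _ hq => hq
      · intro y hy he
        obtain rfl := hinj (he.trans h6)
        exact (List.nodup_append.1 hn).2.2 y hy y (List.mem_cons_of_mem _ hqr) rfl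
      · obtain ⟨s₁, hs₁, hf₁, hL₁⟩ :=
          eval_climbBody_left h0 ht' e7 e8 (hf.2.trans h31) eL
        have h6' : s₁ 6 = addr q := ((hf₁.1 6 (by norm_num)).trans (hf.1 6 (by norm_num))).trans h6
        refine Runs.while_true loopFree_climbBody ?_ ?_
        · simp only [Cmp.Holds]
          rw [e8, hf.1 6 (by norm_num), h6]
          exact fun he => ne_of_nodup_append_cons hn q (.inr hqr) (hinj he).symm
        · rw [hs₁]
          have hneg : (ofList val ((L ++ A) ++ [x])).up + (ofList val (inorder r)).down < 0 := by
            refine ofList_append_down_neg hdx (lt_of_le_of_lt ?_ hq)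
            have := ofList_append_down_le (val := val) ((L ++ B) ++ [q]) C
            simpa [h1, h2] using this
          obtain ⟨f8, f9, fL⟩ := eval_advance_stop h0 ht'
            ((hf₁.1 8 (by norm_num)).trans e8) (hf₁.2.trans (hf.2.trans h31)) hL₁
            (by rw [h6']; exact h0 q) hneg
          simp only [StoredTree] at ht'
          obtain ⟨-, -, -, -, -, -, -, -, -, -, -, -, -, -, hsr⟩ := ht'
          refine Runs.while_false ?_ ⟨hf.trans ((hf₁.mono (by norm_num)).trans (frame_advance s₁)),
            .inr ⟨_, r, (L ++ A) ++ [x], Y, C, hsr, (List.nodup_append.1 hn).2.1.of_cons, ?_, h2,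
              by simp [h1], f9, fL⟩⟩
          · simp only [Cmp.Holds, f8, (frame_advance s₁).1 6 (by norm_num)]
            simp
          · simp [BinaryTree.height]
            omega
  | @right x p l r A hr ih =>
    intro par ht hn s L B C hA h8 h31 hL h6 hd hq
    simp only [StoredTree] at ht
    obtain ⟨-, -, -, -, -, -, -, -, -, -, -, -, -, -, hsr⟩ := ht
    have hh : r.height + 1 ≤ (BinaryTree.node x l r).height := by simp [BinaryTree.height]
    refine (ih hsr (List.nodup_append.1 hn).2.1.of_cons hA h8 h31 hL h6 hd hq).mono
      (by nlinarith) fun s' hs' => ?_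
    exact ⟨hs'.1, hs'.2.mono (by omega)⟩

/-- The effect of a step downwards. -/
theorem eval_descendBody (h0 : ∀ p, addr p ≠ 0) {par : ℤ} {x : Paren α}
    {l r : BinaryTree (Paren α)} (ht : StoredTree val addr h par (.node x l r)) {s : Regs}
    (h9 : s 9 = addr x) (h31 : s 31 = 0) {L : List (Paren α)} (hL : Acc addr s (ofList val L)) :
    if (ofList val L).up + (ofList val (inorder l)).down < 0 then
      descendBody.eval h s 9 = rootPtr addr l ∧ Acc addr (descendBody.eval h s) (ofList val L)
    else if addr x = s 6 then
      descendBody.eval h s 9 = 0 ∧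
        Acc addr (descendBody.eval h s) (ofList val (L ++ inorder l))
    else
      descendBody.eval h s 9 = rootPtr addr r ∧
        Acc addr (descendBody.eval h s) (ofList val ((L ++ inorder l) ++ [x])) := by
  have ht' := ht
  simp only [StoredTree] at ht
  obtain ⟨e1, e2, -, -, -, -, -, -, -, -, -, -, -, hsl, hsr⟩ := ht
  rw [descendBody, eval]
  generalize hs₁ : (block [load 16 9 .left, copy 17 10,
    ite .ne 16 31 (block [load 18 16 .down, add 17 10 18]) skip]).eval h s = s₁
  have hf₁ : Frame 16 s s₁ := hs₁ ▸ frame_eval h (by decide) s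
  have a16 : s₁ 16 = rootPtr addr l := by
    rw [← hs₁]
    by_cases hz : rootPtr addr l = 0 <;>
      simp [block, eval, update, Cmp.Holds, h9, e1, h31, hz]
  have a17 : s₁ 17 = (ofList val L).up + (ofList val (inorder l)).down := by
    rw [← hs₁]
    by_cases hl : l = .nil
    · subst hl
      simp only [rootPtr] at e1
      simp [block, eval, update, Cmp.Holds, h9, e1, h31, hL.up, inorder, ofList, Summary.empty]
    · have := rootPtr_ne_zero h0 hl
      simp [block, eval, update, Cmp.Holds, h9, e1, h31, hL.up, hsl.down hl, this]
  have hL₁ := hL.congr hf₁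
  have a9 : s₁ 9 = addr x := (hf₁.1 9 (by norm_num)).trans h9
  have a6 : s₁ 6 = s 6 := hf₁.1 6 (by norm_num)
  have a31 : s₁ 31 = 0 := hf₁.2.trans h31
  clear hs₁
  split_ifs with c1 c2
  · rw [eval_ite_pos (by simpa [Cmp.Holds, a17, a31] using c1)]
    exact ⟨by simp [eval, a16], hL₁.eval (by decide)⟩
  all_goals
    rw [eval_ite_neg (by simpa [Cmp.Holds, a17, a31] using c1), eval]
    have hf₂ : Frame 10 s₁ ((ite .ne 16 31 appendTree skip).eval h s₁) :=
      frame_eval h (by decide) s₁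
    have hL₂ : Acc addr ((ite .ne 16 31 appendTree skip).eval h s₁)
        (ofList val (L ++ inorder l)) := by
      by_cases hl : l = .nil
      · subst hl
        simp only [rootPtr] at a16
        simpa [eval, Cmp.Holds, a16, a31, inorder] using hL₁
      · have := rootPtr_ne_zero h0 hl
        rw [eval_ite_pos (by simpa [Cmp.Holds, a16, a31] using this)]
        exact eval_appendTree h0 hsl hl a16 a31 hL₁
    generalize (ite .ne 16 31 appendTree skip).eval h s₁ = s₂ at *
    have b9 : s₂ 9 = addr x := (hf₂.1 9 (by norm_num)).trans a9
    have b6 : s₂ 6 = s 6 := (hf₂.1 6 (by norm_num)).trans a6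
    have b31 : s₂ 31 = 0 := hf₂.2.trans a31
  · rw [eval_ite_pos (by simpa [Cmp.Holds, b9, b6] using c2)]
    exact ⟨by simp [eval, b31], hL₂.eval (by decide)⟩
  · have e : (Prog.seq (.seq (copy 16 9) appendParen) (load 9 9 .right)).eval h s₂ =
        (load 9 9 .right).eval h (appendParen.eval h ((copy 16 9).eval h s₂)) := rfl
    rw [eval_ite_neg (by simpa [Cmp.Holds, b9, b6] using c2), e]
    have hf₃ : Frame 10 s₂ (appendParen.eval h ((copy 16 9).eval h s₂)) :=
      frame_eval h (P := .seq (copy 16 9) appendParen) (by decide) s₂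
    have hL₃ := eval_appendParen h0 ht' (s := (copy 16 9).eval h s₂) (by simp [eval, b9])
      (by simp [eval, update, b31]) (hL₂.eval (by decide))
    generalize appendParen.eval h ((copy 16 9).eval h s₂) = s₃ at *
    exact ⟨by simp [eval, hf₃.1 9 (by norm_num), b9, e2], hL₃.eval (by decide)⟩

/-- The walk downwards ends at the sought entry. -/
theorem descend_runs (hinj : Function.Injective addr) (h0 : ∀ p, addr p ≠ 0) {q : Paren α} :
    ∀ {t : BinaryTree (Paren α)} {par : ℤ}, StoredTree val addr h par t → (inorder t).Nodup →
    ∀ {s : Regs} {L B C : List (Paren α)}, inorder t = B ++ q :: C →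
    s 9 = rootPtr addr t → s 31 = 0 → Acc addr s (ofList val L) → s 6 = addr q →
    (ofList val (L ++ B)).down = 0 → (ofList val ((L ++ B) ++ [q])).down < 0 →
    Runs h descend s ((descendBody.cost + 1) * t.height + 1)
      fun s' => Frame 7 s s' ∧ Acc addr s' (ofList val (L ++ B))
  | .nil, par, ht, hn, s, L, B, C, he, h9, h31, hL, h6, hd, hq => by simp [inorder] at he
  | .node x l r, par, ht, hn, s, L, B, C, he, h9, h31, hL, h6, hd, hq => by
    have hb := eval_descendBody h0 ht h9 h31 hL
    have ht' := ht
    simp only [StoredTree] at ht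
    obtain ⟨-, -, -, -, -, -, -, -, -, -, -, -, -, hsl, hsr⟩ := ht
    have hhl : l.height + 1 ≤ (BinaryTree.node x l r).height := by simp [BinaryTree.height]
    have hhr : r.height + 1 ≤ (BinaryTree.node x l r).height := by simp [BinaryTree.height]
    have hf : Frame 7 s (descendBody.eval h s) := frame_eval h (by decide) s
    have hrun : ∀ {n : ℕ} {Q : Regs → Prop}, Runs h descend (descendBody.eval h s) n Q →
        Runs h descend s (n + (descendBody.cost + 1)) Q := fun H =>
      Runs.while_true loopFree_descendBody
        (by simp only [Cmp.Holds, h9, h31]; exact h0 x) H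
    have g6 := (hf.1 6 (by norm_num)).trans h6
    have g31 := hf.2.trans h31
    rcases append_cons_eq_append_cons he with ⟨X, h1, h2⟩ | ⟨h1, h2, h3⟩ | ⟨Y, h1, h2⟩
    -- The sought entry lies in the left subtree: the drop below 0 at `q` makes the test for `l`
    -- negative.
    · have hneg : (ofList val L).up + (ofList val (inorder l)).down < 0 := by
        refine ofList_append_down_neg (ofList_append_down_eq_zero hd).1 (lt_of_le_of_lt ?_ hq)
        have := ofList_append_down_le (val := val) ((L ++ B) ++ [q]) X
        simpa [h1] using this
      rw [if_pos hneg] at hb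
      refine (hrun (descend_runs hinj h0 hsl (List.nodup_append.1 hn).1 h1 hb.1 g31 hb.2 g6 hd
        hq)).mono (by nlinarith) fun s' hs' => ⟨hf.trans hs'.1, hs'.2⟩
    · subst h1 h2
      rw [if_neg (not_lt.2 (ofList_append_down_eq_zero hd).2), if_pos h6.symm] at hb
      refine (hrun (Runs.while_false ?_ ⟨hf, hb.2⟩)).mono (by nlinarith) fun s' hs' => hs'
      simp only [Cmp.Holds, hb.1, g31]
      simp
    · have hd' : (ofList val ((L ++ inorder l) ++ x :: Y)).down = 0 := by simpa [h1] using hd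
      have hqr : q ∈ inorder r := by simp [h2]
      rw [if_neg (not_lt.2 (ofList_append_down_eq_zero (ofList_append_down_eq_zero hd').1).2),
        if_neg fun e => ne_of_nodup_append_cons hn q (.inr hqr) (hinj (e.trans h6)).symm] at hb
      have hB : L ++ B = ((L ++ inorder l) ++ [x]) ++ Y := by simp [h1]
      rw [hB] at hd hq ⊢
      refine (hrun (descend_runs hinj h0 hsr (List.nodup_append.1 hn).2.1.of_cons h2 hb.1 g31
        hb.2 g6 hd hq)).mono (by nlinarith) fun s' hs' => ⟨hf.trans hs'.1, hs'.2⟩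

end Segment
end DFT

namespace DFT

/-! ### Forests that are spread over several search trees -/

namespace OForest

variable {α : Type*}

theorem nodes_append (f g : OForest α) : (f.append g).nodes = f.nodes ++ g.nodes := by
  induction f with
  | nil => rfl
  | node a c s _ ih => simp [append, nodes, ih]

theorem childSubtrees_append_left {f : OForest α} (g : OForest α) {v : α} (hv : v ∈ f.nodes) :
    (f.append g).childSubtrees v = f.childSubtrees v := by
  induction f with
  | nil => simp [nodes] at hv
  | node a c s _ ih =>
    simp only [nodes, List.mem_cons, List.mem_append] at hv
    simp only [append, childSubtrees]
    split_ifs with h1 h2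
    · rfl
    · rfl
    · exact ih (by tauto)

theorem childSubtrees_append_right {f : OForest α} (g : OForest α) {v : α} (hv : v ∉ f.nodes) :
    (f.append g).childSubtrees v = g.childSubtrees v := by
  induction f with
  | nil => rfl
  | node a c s _ ih =>
    simp only [nodes, List.mem_cons, List.mem_append, not_or] at hv
    rw [append, childSubtrees, if_neg hv.1, if_neg hv.2.1, ih hv.2.2]

theorem rootOf_append_left {f : OForest α} (g : OForest α) {v : α} (hv : v ∈ f.nodes) :
    (f.append g).rootOf v = f.rootOf v := by
  induction f with
  | nil => simp [nodes] at hv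
  | node a c s _ ih =>
    simp only [nodes, List.mem_cons, List.mem_append] at hv
    simp only [append, rootOf]
    split_ifs with h1
    · rfl
    · exact ih (by tauto)

theorem rootOf_append_right {f : OForest α} (g : OForest α) {v : α} (hv : v ∉ f.nodes) :
    (f.append g).rootOf v = g.rootOf v := by
  induction f with
  | nil => rfl
  | node a c s _ ih =>
    simp only [nodes, List.mem_cons, List.mem_append, not_or] at hv
    rw [append, rootOf, if_neg (by tauto), ih hv.2.2]

theorem mem_nodes_of_rootOf {f : OForest α} {v root : α} (h : f.rootOf v = some root) :
    root ∈ f.nodes := by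
  induction f with
  | nil => simp [rootOf] at h
  | node a c s _ ih =>
    rw [rootOf] at h
    split_ifs at h with h1
    · simp_all [nodes]
    · simp [nodes, ih h]

theorem mem_tour {f : OForest α} {p : Paren α} : p ∈ f.tour ↔ p.node ∈ f.nodes := by
  induction f with
  | nil => simp [tour, nodes]
  | node a c s ihc ihs =>
    obtain ⟨b, o⟩ := p
    cases o <;> simp [tour, nodes, ihc, ihs, or_left_comm]

theorem nodup_tour {f : OForest α} (hf : f.nodes.Nodup) : f.tour.Nodup := by
  induction f with
  | nil => simp [tour]
  | node a c s ihc ihs =>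
    simp only [nodes, List.nodup_cons, List.mem_append, not_or, List.nodup_append] at hf
    obtain ⟨⟨h1, h2⟩, h3, h4, h5⟩ := hf
    simp only [tour, List.nodup_cons, List.mem_append, List.mem_cons, List.nodup_append, mem_tour,
      not_or]
    refine ⟨⟨h1, by simp, h2⟩, ihc h3, ⟨h2, ihs h4⟩, ?_⟩
    rintro x hx y (rfl | hy) rfl
    · exact h1 hx
    · exact h5 _ hx _ hy rfl

theorem length_tour (f : OForest α) : f.tour.length = 2 * f.nodes.length := by
  induction f with
  | nil => rfl
  | node a c s ihc ihs => simp [tour, nodes, ihc, ihs]; omega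

end OForest

section Parts

variable {α : Type*}

open OForest

theorem exists_part_of_mem {v : α} : ∀ {D : List (Part α)}, v ∈ (forestOf D).nodes →
    ∃ p ∈ D, v ∈ p.forest.nodes
  | [], hv => by simp [forestOf, nodes] at hv
  | q :: D, hv => by
    rw [forestOf, nodes_append, List.mem_append] at hv
    rcases hv with hv | hv
    · exact ⟨q, by simp, hv⟩
    · obtain ⟨p, hp, h⟩ := exists_part_of_mem hv
      exact ⟨p, by simp [hp], h⟩

theorem sublist_nodes_forestOf {p : Part α} : ∀ {D : List (Part α)}, p ∈ D →
    p.forest.nodes.Sublist (forestOf D).nodes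
  | q :: D, hp => by
    rw [forestOf, nodes_append]
    rcases List.mem_cons.1 hp with rfl | hp
    · exact List.sublist_append_left _ _
    · exact (sublist_nodes_forestOf hp).trans (List.sublist_append_right _ _)

/-- Nodes are not repeated, so no other search tree contains `v`, and the recursive searches skip
the other trees. -/
theorem forestOf_eq_part {p : Part α} {v : α} (hv : v ∈ p.forest.nodes) :
    ∀ {D : List (Part α)}, (forestOf D).nodes.Nodup → p ∈ D →
    (forestOf D).childSubtrees v = p.forest.childSubtrees v ∧
      (forestOf D).rootOf v = p.forest.rootOf v
  | q :: D, hn, hp => by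
    rw [forestOf, nodes_append] at hn
    rw [forestOf]
    rcases List.mem_cons.1 hp with rfl | hp
    · exact ⟨childSubtrees_append_left _ hv, rootOf_append_left _ hv⟩
    · have hq : v ∉ q.forest.nodes := fun h =>
        (List.nodup_append.1 hn).2.2 v h v ((sublist_nodes_forestOf hp).subset hv) rfl
      rw [childSubtrees_append_right _ hq, rootOf_append_right _ hq]
      exact forestOf_eq_part hv (List.nodup_append.1 hn).2.1 hp

end Parts

/-! ### The program -/

namespace Prog

/-- Reset the accumulated summary. -/
def clearSummary : Prog :=
  block [copy 10 31, copy 11 31, copy 12 31, copy 13 31, copy 14 31, copy 15 31]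

/-- Accumulate the summary of the part of the tour strictly between the open-node in register 5
and its twin. -/
def segment : Prog :=
  seq (seq (block [load 6 5 .twin, copy 8 5]) (seq clearSummary advance)) (seq climb descend)

/-- Find the open-node of the root of the tree that contains the close-node in register 6. -/
def findRoot : Prog :=
  seq (seq (seq (block [copy 8 6, copy 16 6, copy 6 31]) clearSummary) (seq appendParen advance))
    (seq climb (load 1 11 .twin))

/-- Compute the sum at the root and the impact from the results of `segment`. -/
def finish : Prog :=
  block [load 20 5 .val, add 2 20 13, sub 20 2 3, ite .lt 20 4 (copy 20 4) skip, const 21 1,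
    sub 0 2 21, sub 0 0 20]

/-- The program that answers impact queries. -/
def query : Prog :=
  seq (block [const 31 0, copy 5 0]) <| seq segment <|
  seq (block [load 20 5 .val, add 3 20 13, copy 4 14]) <| seq findRoot <|
  seq (copy 5 1) <| seq segment finish

end Prog

/-! ### Correctness and cost of the query program -/

section Query

variable {α : Type*} {addr : Paren α → ℤ} {h : Heap} {val : α → ℕ}

open Prog Summary
open Function (update update_of_ne)

theorem StoredTree.exists_of_mem {p : Paren α} : ∀ {t : BinaryTree (Paren α)} {par : ℤ},
    StoredTree val addr h par t → p ∈ inorder t →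
    ∃ par' l r, StoredTree val addr h par' (.node p l r)
  | .nil, par, ht, hp => by simp [inorder] at hp
  | .node q l r, par, ht, hp => by
    have ht' := ht
    simp only [StoredTree] at ht'
    obtain ⟨-, -, -, -, -, -, -, -, -, -, -, -, -, hl, hr⟩ := ht'
    simp only [inorder, List.mem_append, List.mem_cons] at hp
    rcases hp with hp | rfl | hp
    · exact hl.exists_of_mem hp
    · exact ⟨par, l, r, ht⟩
    · exact hr.exists_of_mem hp

theorem eval_clearSummary {s : Regs} (h31 : s 31 = 0) :
    Acc addr (clearSummary.eval h s) (ofList val []) := by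
  constructor <;> simp [clearSummary, block, eval, update, h31, ofList, Summary.empty, optPtr]

/-- A number of steps per unit of height. -/
def stepCost : ℕ := climbBody.cost + descendBody.cost + 2

/-- The hypotheses on `B` make the twin the first entry after `p` with negative relative depth,
which is what the two loops look for. If the climb meets the twin directly, register 9 is 0 and the
descent is empty. -/
theorem segment_runs (hinj : Function.Injective addr) (h0 : ∀ p, addr p ≠ 0)
    {t : BinaryTree (Paren α)} (ht : StoredTree val addr h 0 t) (hn : (inorder t).Nodup)
    {p : Paren α} {A B C : List (Paren α)} (he : inorder t = A ++ p :: (B ++ p.twin :: C))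
    (hd : (ofList val B).down = 0) (hq : (ofList val (B ++ [p.twin])).down < 0)
    {s : Regs} (h5 : s 5 = addr p) (h31 : s 31 = 0) :
    Runs h Prog.segment s (stepCost * t.height + Prog.segment.cost) fun s' =>
      Frame 6 s s' ∧ s' 6 = addr p.twin ∧ Acc addr s' (ofList val B) := by
  obtain ⟨par, l, r, hp⟩ := ht.exists_of_mem (p := p) (by simp [he])
  set s₁ := (block [load 6 5 .twin, copy 8 5]).eval h s with hs₁
  set s₂ := clearSummary.eval h s₁ with hs₂
  have hf₁ : Frame 6 s s₁ := frame_eval h (by decide) s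
  have hf₂ : Frame 10 s₁ s₂ := frame_eval h (by decide) s₁
  have a6 : s₂ 6 = addr p.twin := by
    rw [hf₂.1 6 (by norm_num), hs₁]
    simp [block, eval, update, h5, hp.2.2.2.1]
  have a8 : s₂ 8 = addr p := by
    rw [hf₂.1 8 (by norm_num), hs₁]
    simp [block, eval, update, h5]
  have a31 : s₂ 31 = 0 := (hf₂.2.trans hf₁.2).trans h31
  have hL : Acc addr s₂ (ofList val []) := eval_clearSummary (hf₁.2.trans h31)
  have hc := climb_found hinj h0 (After.of_inorder_eq he) ht hn (B := B) (C := C) rfl a8 a31 hL a6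
    (by simpa using hd) (by simpa using hq)
  have hc' : Runs h climb (advance.eval h s₂) ((climbBody.cost + 1) * t.height + 1) fun s' =>
      Runs h descend s' ((descendBody.cost + 1) * t.height + 1) fun s'' =>
        Frame 6 s s'' ∧ s'' 6 = addr p.twin ∧ Acc addr s'' (ofList val B) := by
    refine hc.mono le_rfl ?_
    rintro s' ⟨hf, hfound⟩
    have hf' : Frame 6 s s' := hf₁.trans ((hf₂.mono (by norm_num)).trans (hf.mono (by norm_num)))
    have b6 := (hf.1 6 (by norm_num)).trans a6
    have b31 := hf.2.trans a31
    rcases hfound with ⟨h9, hA⟩ | ⟨par', t', L', B', C', ht', hn', hh, he', hLB, h9, hA⟩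
    · refine (Runs.while_false ?_ ⟨hf', b6, hA⟩).mono (by omega) fun _ hq => hq
      simp [Cmp.Holds, h9, b31]
    · rw [List.nil_append] at hLB
      refine (descend_runs hinj h0 ht' hn' he' h9 b31 hA b6 (hLB ▸ hd) (hLB ▸ hq)).mono
        (by nlinarith) ?_
      rintro s'' ⟨hf'', hA'⟩
      exact ⟨hf'.trans (hf''.mono (by norm_num)), (hf''.1 6 (by norm_num)).trans b6, hLB ▸ hA'⟩
  refine (Runs.eval_seq (P := seq (block [load 6 5 .twin, copy 8 5]) (seq clearSummary advance))
    (by simp [LoopFree, block, clearSummary, advance, appendPending, appendTree, loadTree,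
      appendSummary]) (Runs.seq hc')).mono ?_ fun _ hq => hq
  -- Each of the two loops has nominal cost 1, which pays for its final failing comparison; the
  -- iterations are charged to the height.
  have e : Prog.segment.cost =
    (seq (block [load 6 5 .twin, copy 8 5]) (seq clearSummary advance)).cost + 2 := rfl
  rw [e, stepCost]
  generalize cost _ = k
  nlinarith

/-- With target 0 no subtree stops the walk. It ends at the null parent of the search tree's root,
having accumulated everything from `p` to the end, so register 11 points to the leftmost entry of
minimal depth. -/
theorem findRoot_runs (hinj : Function.Injective addr) (h0 : ∀ p, addr p ≠ 0)
    {t : BinaryTree (Paren α)} (ht : StoredTree val addr h 0 t) (hn : (inorder t).Nodup)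
    {p q : Paren α} {A B : List (Paren α)} (he : inorder t = A ++ p :: B)
    (hB : (ofList val (p :: B)).first = some q) (hq : q ∈ inorder t)
    {s : Regs} (h6 : s 6 = addr p) (h31 : s 31 = 0) :
    Runs h findRoot s (stepCost * t.height + findRoot.cost) fun s' =>
      (∀ i < 6, i ≠ 1 → s' i = s i) ∧ s' 31 = 0 ∧ s' 1 = addr q.twin := by
  obtain ⟨par, l, r, hp⟩ := ht.exists_of_mem (p := p) (by simp [he])
  obtain ⟨par', l', r', hq'⟩ := ht.exists_of_mem hq
  set s₁ := (block [copy 8 6, copy 16 6, copy 6 31]).eval h s with hs₁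
  set s₂ := clearSummary.eval h s₁ with hs₂
  set s₃ := appendParen.eval h s₂ with hs₃
  have hf₁ : Frame 6 s s₁ := frame_eval h (by decide) s
  have hf₂ : Frame 10 s₁ s₂ := frame_eval h (by decide) s₁
  have hf₃ : Frame 10 s₂ s₃ := frame_eval h (by decide) s₂
  have a16 : s₂ 16 = addr p := by
    rw [hs₂, clearSummary.eval_of_notMem_writes h s₁ (by decide), hs₁]
    simp [block, eval, update, h6]
  have a8 : s₃ 8 = addr p := by
    rw [hf₃.1 8 (by norm_num), hf₂.1 8 (by norm_num), hs₁]
    simp [block, eval, update, h6]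
  have a6 : s₃ 6 = 0 := by
    rw [hf₃.1 6 (by norm_num), hf₂.1 6 (by norm_num), hs₁]
    simp [block, eval, update, h31]
  have a31 : s₂ 31 = 0 := (hf₂.2.trans hf₁.2).trans h31
  have hL : Acc addr s₃ (ofList val [p]) :=
    eval_appendParen h0 hp a16 a31 (eval_clearSummary (hf₁.2.trans h31))
  have hc := climb_through hinj h0 (After.of_inorder_eq he) ht hn a8 (hf₃.2.trans a31) hL
    (fun x _ => by rw [a6]; exact h0 x) (fun hne => absurd a6 hne) (n := 1)
    (Q := fun s' => Runs h (load 1 11 .twin) s' 1 fun s'' =>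
      (∀ i < 6, i ≠ 1 → s'' i = s i) ∧ s'' 31 = 0 ∧ s'' 1 = addr q.twin) ?_
  · refine (Runs.eval_seq (P := seq (seq (block [copy 8 6, copy 16 6, copy 6 31]) clearSummary)
      (seq appendParen advance))
      (by simp [LoopFree, block, clearSummary, advance, appendPending, appendTree, loadTree,
        appendSummary, appendParen, loadParen]) (Runs.seq hc)).mono ?_ fun _ hq => hq
    -- The 2 pays for the last loop test and for loading the twin.
    have e : findRoot.cost = (seq (seq (block [copy 8 6, copy 16 6, copy 6 31]) clearSummary)
      (seq appendParen advance)).cost + 2 := rfl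
    rw [e, stepCost]
    generalize cost (seq _ _) = k
    nlinarith
  · intro s' hf e7 e8 e9 eL
    have hf' : Frame 6 s s' :=
      hf₁.trans (((hf₂.trans hf₃).mono (by norm_num)).trans (hf.mono (by norm_num)))
    refine Runs.while_false ?_ ?_
    · simp [Cmp.Holds, e8, hf.1 6 (by norm_num), a6]
    · refine Runs.of_eval (P := load 1 11 .twin) trivial ⟨?_, ?_, ?_⟩
      · intro i hi hi1
        rw [eval, update_of_ne hi1, hf'.1 i hi]
      · simp [eval, update, hf'.2, h31]
      · have := eL.first
        rw [List.singleton_append, hB, optPtr] at this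
        simp [eval, this, hq'.2.2.2.1]

/-- Between the two tour entries of `v` lies the tour of its child subtrees, so `ofList_tour` gives
the two results. Only the value of `v` itself is missing from the sum. -/
theorem segment_subtree_runs (hinj : Function.Injective addr) (h0 : ∀ p, addr p ≠ 0)
    {D : List (Part α)} (hn : (forestOf D).nodes.Nodup) {p : Part α} (hp : p ∈ D)
    (ht : StoredTree val addr h 0 p.bst) {v : α} (hv : v ∈ p.forest.nodes)
    {s : Regs} (h5 : s 5 = addr ⟨v, true⟩) (h31 : s 31 = 0) :
    Runs h Prog.segment s (stepCost * p.bst.height + Prog.segment.cost) fun s' =>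
      Frame 6 s s' ∧ s' 6 = addr ⟨v, false⟩ ∧
      val v + s' 13 = (forestOf D).subtreeSum val v ∧
      s' 14 = (forestOf D).maxsumChild val v := by
  obtain ⟨A, B, root, htour, -⟩ := OForest.exists_tour_eq val v p.forest hv
  obtain ⟨o, ho⟩ := ofList_tour val (p.forest.childSubtrees v)
  have hnt := OForest.nodup_tour (hn.sublist (sublist_nodes_forestOf hp))
  rw [← p.inorder_bst] at hnt htour
  refine (segment_runs hinj h0 ht hnt htour (by rw [ho]) ?_ h5 h31).mono le_rfl ?_
  · change (ofList val (_ ++ [⟨v, false⟩])).down < 0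
    rw [ofList_concat, ho, single_close, append_of_neg (by simp)]
    simp
  · rintro s' ⟨hf, h6, hA⟩
    refine ⟨hf, h6, ?_, ?_⟩
    · rw [hA.bodySum, ho, OForest.subtreeSum, (forestOf_eq_part hv hn hp).1]
      simp
    · rw [hA.bodyMax, ho, OForest.maxsumChild_eq, (forestOf_eq_part hv hn hp).1]

/-- The factor 3 counts the walks: the segment of `v`, the search for the root, and the segment of
the root. All three take place in the one search tree that holds `v`. -/
theorem exists_query_runs (hinj : Function.Injective addr) (h0 : ∀ p, addr p ≠ 0)
    {D : List (Part α)} (hn : (forestOf D).nodes.Nodup)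
    (ht : ∀ p ∈ D, StoredTree val addr h 0 p.bst) {v : α} (hv : v ∈ (forestOf D).nodes)
    {s : Regs} (hs : s 0 = addr ⟨v, true⟩) :
    ∃ p ∈ D, ∃ root, (forestOf D).rootOf v = some root ∧
      Runs h query s (3 * stepCost * p.bst.height + query.cost) fun s' =>
        s' 1 = addr ⟨root, true⟩ ∧
        s' 2 = (forestOf D).subtreeSum val root ∧
        s' 3 = (forestOf D).subtreeSum val v ∧
        s' 4 = (forestOf D).maxsumChild val v ∧
        s' 0 = (s' 2 - 1) - max (s' 4) (s' 2 - s' 3) := by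
  obtain ⟨p, hp, hvp⟩ := exists_part_of_mem hv
  obtain ⟨A, B, root, htour, hroot, -, hfirst⟩ := OForest.exists_tour_eq val v p.forest hvp
  have hrootp := OForest.mem_nodes_of_rootOf hroot
  have hnt := OForest.nodup_tour (hn.sublist (sublist_nodes_forestOf hp))
  have hst := ht p hp
  have valof : ∀ w ∈ p.forest.nodes, h (addr ⟨w, true⟩) .val = val w := by
    intro w hw
    obtain ⟨par, l, r, hw'⟩ := hst.exists_of_mem (p := ⟨w, true⟩)
      (by rw [p.inorder_bst, OForest.mem_tour]; exact hw)
    exact hw'.2.2.2.2.2.1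
  have hrootmem : (⟨root, false⟩ : Paren α) ∈ inorder p.bst := by
    rw [p.inorder_bst, OForest.mem_tour]; exact hrootp
  rw [← p.inorder_bst] at hnt htour
  have htour' : inorder p.bst = (A ++ ⟨v, true⟩ :: (p.forest.childSubtrees v).tour) ++
      ⟨v, false⟩ :: B := by simpa using htour
  refine ⟨p, hp, root, (forestOf_eq_part hvp hn hp).2.trans hroot, ?_⟩
  set Q : Regs → Prop := fun s' => s' 1 = addr ⟨root, true⟩ ∧
    s' 2 = (forestOf D).subtreeSum val root ∧ s' 3 = (forestOf D).subtreeSum val v ∧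
    s' 4 = (forestOf D).maxsumChild val v ∧ s' 0 = (s' 2 - 1) - max (s' 4) (s' 2 - s' 3)
  -- The stages are treated from the last to the first, so that each can serve as the continuation
  -- of the preceding one.
  have k₁ : ∀ s' : Regs, s' 1 = addr ⟨root, true⟩ → s' 5 = addr ⟨root, true⟩ →
      s' 3 = (forestOf D).subtreeSum val v → s' 4 = (forestOf D).maxsumChild val v →
      val root + s' 13 = (forestOf D).subtreeSum val root →
      Runs h finish s' finish.cost Q := by
    intro s' h1 h5 h3 h4 h13
    have hr := valof root hrootp
    refine Runs.of_eval (by simp [finish, block, LoopFree]) ?_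
    by_cases hlt : ((forestOf D).subtreeSum val root : ℤ) - (forestOf D).subtreeSum val v <
      (forestOf D).maxsumChild val v
    · have := max_eq_left hlt.le
      simp [Q, finish, block, eval, update, Cmp.Holds, *]
    · have := max_eq_right (not_lt.1 hlt)
      simp [Q, finish, block, eval, update, Cmp.Holds, *]
  have k₂ : ∀ s' : Regs, s' 1 = addr ⟨root, true⟩ → s' 3 = (forestOf D).subtreeSum val v →
      s' 4 = (forestOf D).maxsumChild val v → s' 31 = 0 →
      Runs h (.seq (copy 5 1) (.seq Prog.segment finish)) s' ((copy 5 1).cost +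
        (stepCost * p.bst.height + Prog.segment.cost + finish.cost)) Q := by
    intro s' h1 h3 h4 h31
    refine Runs.eval_seq trivial (Runs.seq ((segment_subtree_runs hinj h0 hn hp hst hrootp
      (by simp [eval, h1]) (by simp [eval, update, h31])).mono le_rfl ?_))
    rintro s'' ⟨hf, -, h13, -⟩
    refine k₁ s'' ?_ ?_ ?_ ?_ h13 <;> rw [hf.1 _ (by norm_num)] <;> simp [eval, update, *]
  have k₃ : ∀ s' : Regs, s' 5 = addr ⟨v, true⟩ → s' 6 = addr ⟨v, false⟩ →
      val v + s' 13 = (forestOf D).subtreeSum val v → s' 14 = (forestOf D).maxsumChild val v →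
      s' 31 = 0 →
      Runs h (.seq (block [load 20 5 .val, add 3 20 13, copy 4 14])
        (.seq findRoot (.seq (copy 5 1) (.seq Prog.segment finish)))) s'
        ((block [load 20 5 .val, add 3 20 13, copy 4 14]).cost +
          (stepCost * p.bst.height + findRoot.cost + ((copy 5 1).cost +
            (stepCost * p.bst.height + Prog.segment.cost + finish.cost)))) Q := by
    intro s' h5 h6 h13 h14 h31
    refine Runs.eval_seq (by simp [block, LoopFree]) (Runs.seq ((findRoot_runs hinj h0 hst hnt
      htour' hfirst hrootmem (by simp [block, eval, update, h6])
      (by simp [block, eval, update, h31])).mono le_rfl ?_))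
    rintro s'' ⟨hf, g31, g1⟩
    refine k₂ s'' g1 ?_ ?_ g31 <;> rw [hf _ (by norm_num) (by norm_num)] <;>
      simp [block, eval, update, h5, valof v hvp, h14, ← h13]
  have k₄ := Runs.eval_seq (P := block [const 31 0, copy 5 0]) (by simp [block, LoopFree])
    (Runs.seq ((segment_subtree_runs (s := (block [const 31 0, copy 5 0]).eval h s) hinj h0 hn hp
      hst hvp (by simp [block, eval, update, hs]) (by simp [block, eval])).mono le_rfl
      fun s' ⟨hf, g6, h13, h14⟩ => k₃ s' (by rw [hf.1 5 (by norm_num)]; simp [block, eval, hs])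
        g6 h13 h14 (by rw [hf.2]; simp [block, eval])))
  refine k₄.mono ?_ fun _ hq => hq
  have e : query.cost = (block [const 31 0, copy 5 0]).cost + (Prog.segment.cost +
      ((block [load 20 5 .val, add 3 20 13, copy 4 14]).cost + (findRoot.cost +
      ((copy 5 1).cost + (Prog.segment.cost + finish.cost))))) := rfl
  rw [e]
  nlinarith

end Query
end DFT

namespace DFT

/-! ### Connectivity in rooted forests -/

theorem reflTransGen_mono {α : Type*} {r p : α → α → Prop} (h : ∀ x y, r x y → p x y) {x y : α}
    (hxy : Relation.ReflTransGen r x y) : Relation.ReflTransGen p x y :=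
  hxy.lift id h

theorem perm_cons_of_perm_cons {α : Type*} {v a : α} {f C G : List α}
    (h : f.Perm (v :: (C ++ G))) : (a :: f).Perm (v :: (C ++ a :: G)) := by
  classical
  rw [List.perm_iff_count] at h ⊢
  intro x
  have := h x
  simp only [List.count_cons, List.count_append] at this ⊢
  omega

theorem perm_append_of_perm_cons {α : Type*} {v a : α} {f C G : List α} (S : List α)
    (h : f.Perm (v :: (C ++ G))) : (a :: (f ++ S)).Perm (v :: (C ++ a :: (G ++ S))) := by
  classical
  rw [List.perm_iff_count] at h ⊢
  intro x
  have := h x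
  simp only [List.count_cons, List.count_append] at this ⊢
  omega

theorem perm_append_of_perm_cons_right {α : Type*} {v a : α} {S C G : List α} (f : List α)
    (h : S.Perm (v :: (C ++ G))) : (a :: (f ++ S)).Perm (v :: (C ++ a :: (f ++ G))) := by
  classical
  rw [List.perm_iff_count] at h ⊢
  intro x
  have := h x
  simp only [List.count_cons, List.count_append] at this ⊢
  omega

namespace OForest

variable {α : Type*}

theorem roots_subset_nodes (f : OForest α) : f.roots ⊆ f.nodes := by
  induction f with
  | nil => simp [roots]
  | node a c s _ ih =>
    intro x hx
    rcases List.mem_cons.1 hx with rfl | hx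
    · simp [nodes]
    · simp [nodes, ih hx]

theorem IsChild.mem {f : OForest α} {x y : α} (h : f.IsChild x y) :
    x ∈ f.nodes ∧ y ∈ f.nodes := by
  induction f with
  | nil => exact h.elim
  | node a c s ihc ihs =>
    rcases h with ⟨rfl, h⟩ | h | h
    · simp [nodes, c.roots_subset_nodes h]
    · simp [nodes, ihc h]
    · simp [nodes, ihs h]

theorem mem_nodes_iff {f : OForest α} {x : α} : x ∈ f.nodes ↔ ∃ l ∈ f.treeNodes, x ∈ l := by
  induction f with
  | nil => simp [nodes, treeNodes]
  | node a c s _ ih => simp [nodes, treeNodes, ih, or_assoc]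

theorem treeNodes_sublist {f : OForest α} {l : List α} (hl : l ∈ f.treeNodes) :
    l.Sublist f.nodes := by
  induction f with
  | nil => simp [treeNodes] at hl
  | node a c s _ ih =>
    rw [nodes, ← List.cons_append]
    rcases List.mem_cons.1 hl with rfl | hl
    · exact List.sublist_append_left _ _
    · exact (ih hl).trans (List.sublist_append_right _ _)

theorem treeNodes_append (f g : OForest α) :
    (f.append g).treeNodes = f.treeNodes ++ g.treeNodes := by
  induction f with
  | nil => rfl
  | node a c s _ ih => simp [append, treeNodes, ih]

theorem isChild_append (f g : OForest α) (x y : α) :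
    (f.append g).IsChild x y ↔ f.IsChild x y ∨ g.IsChild x y := by
  induction f with
  | nil => simp [append, IsChild]
  | node a c s _ ih => simp [append, IsChild, ih, or_assoc]

/-- Adjacency in a forest. -/
def Adj (f : OForest α) (x y : α) : Prop := f.IsChild x y ∨ f.IsChild y x

theorem Adj.symm {f : OForest α} {x y : α} (h : f.Adj x y) : f.Adj y x := Or.symm h

theorem nodup_node {a : α} {c s : OForest α} (h : (node a c s).nodes.Nodup) :
    a ∉ c.nodes ∧ a ∉ s.nodes ∧ c.nodes.Nodup ∧ s.nodes.Nodup ∧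
      ∀ x ∈ c.nodes, x ∉ s.nodes := by
  simp only [nodes, List.nodup_cons, List.mem_append, not_or, List.nodup_append] at h
  exact ⟨h.1.1, h.1.2, h.2.1, h.2.2.1, fun x hx hs => h.2.2.2 x hx x hs rfl⟩

theorem exists_root_reflTransGen {f : OForest α} {x : α} (hx : x ∈ f.nodes) :
    ∃ r ∈ f.roots, Relation.ReflTransGen f.IsChild r x := by
  induction f with
  | nil => simp [nodes] at hx
  | node a c s ihc ihs =>
    simp only [nodes, List.mem_cons, List.mem_append] at hx
    rcases hx with rfl | hx | hx
    · exact ⟨x, by simp [roots], .refl⟩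
    · obtain ⟨r, hr, h⟩ := ihc hx
      exact ⟨a, by simp [roots], .head (.inl ⟨rfl, hr⟩) (reflTransGen_mono (fun _ _ h => .inr (.inl h)) h)⟩
    · obtain ⟨r, hr, h⟩ := ihs hx
      exact ⟨r, by simp [roots, hr], reflTransGen_mono (fun _ _ h => .inr (.inr h)) h⟩

theorem exists_reflTransGen_of_mem_treeNodes {f : OForest α} {l : List α}
    (hl : l ∈ f.treeNodes) : ∃ r, ∀ x ∈ l, Relation.ReflTransGen f.IsChild r x := by
  induction f with
  | nil => simp [treeNodes] at hl
  | node a c s _ ih =>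
    rcases List.mem_cons.1 hl with rfl | hl
    · refine ⟨a, fun x hx => ?_⟩
      rcases List.mem_cons.1 hx with rfl | hx
      · exact .refl
      · obtain ⟨r, hr, h⟩ := exists_root_reflTransGen hx
        exact .head (.inl ⟨rfl, hr⟩) (reflTransGen_mono (fun _ _ h => .inr (.inl h)) h)
    · obtain ⟨r, h⟩ := ih hl
      exact ⟨r, fun x hx => reflTransGen_mono (fun _ _ h => .inr (.inr h)) (h x hx)⟩

theorem IsChild.mem_treeNodes_iff {f : OForest α} (hf : f.nodes.Nodup) {x y : α}
    (h : f.IsChild x y) {l : List α} (hl : l ∈ f.treeNodes) : x ∈ l ↔ y ∈ l := by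
  induction f with
  | nil => simp [treeNodes] at hl
  | node a c s _ ih =>
    obtain ⟨h1, h2, h3, h4, h5⟩ := nodup_node hf
    rcases List.mem_cons.1 hl with rfl | hl
    · rcases h with ⟨rfl, h⟩ | h | h
      · simp [c.roots_subset_nodes h]
      · simp [h.mem]
      · obtain ⟨hx, hy⟩ := h.mem
        have h6 : ∀ z ∈ s.nodes, z ∉ a :: c.nodes := by
          rintro z hz hz'
          rcases List.mem_cons.1 hz' with rfl | hz'
          · exact h2 hz
          · exact h5 z hz' hz
        exact iff_of_false (h6 x hx) (h6 y hy)
    · have h6 := (treeNodes_sublist hl).subset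
      rcases h with ⟨rfl, h⟩ | h | h
      · exact iff_of_false (fun hx => h2 (h6 hx))
          fun hy => h5 y (c.roots_subset_nodes h) (h6 hy)
      · exact iff_of_false (fun hx => h5 x h.mem.1 (h6 hx)) fun hy => h5 y h.mem.2 (h6 hy)
      · exact ih h4 h hl

/-- The trees of a forest are its connected components. -/
theorem reflTransGen_adj_iff {f : OForest α} (hf : f.nodes.Nodup) {l : List α}
    (hl : l ∈ f.treeNodes) {x : α} (hx : x ∈ l) {y : α} :
    Relation.ReflTransGen f.Adj x y ↔ y ∈ l := by
  constructor
  · intro h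
    induction h with
    | refl => exact hx
    | tail _ h ih =>
      rcases h with h | h
      · exact (h.mem_treeNodes_iff hf hl).1 ih
      · exact (h.mem_treeNodes_iff hf hl).2 ih
  · intro hy
    obtain ⟨r, hr⟩ := exists_reflTransGen_of_mem_treeNodes hl
    have key : ∀ z ∈ l, Relation.ReflTransGen f.Adj r z := fun z hz =>
      reflTransGen_mono (fun _ _ h => .inl h) (hr z hz)
    have hsymm : Relation.ReflTransGen f.Adj x r := by
      have : Std.Symm f.Adj := ⟨fun _ _ h => h.symm⟩
      exact Relation.ReflTransGen.stdSymm.symm _ _ (key x hx)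
    exact hsymm.trans (key y hy)

theorem IsChild.notMem_roots {f : OForest α} (hf : f.nodes.Nodup) {x y : α}
    (h : f.IsChild x y) : y ∉ f.roots := by
  induction f with
  | nil => exact h.elim
  | node a c s _ ihs =>
    obtain ⟨h1, h2, h3, h4, h5⟩ := nodup_node hf
    simp only [roots, List.mem_cons, not_or]
    rcases h with ⟨rfl, h⟩ | h | h
    · have := c.roots_subset_nodes h
      exact ⟨fun e => h1 (e ▸ this), fun hy => h5 y this (s.roots_subset_nodes hy)⟩
    · exact ⟨fun e => h1 (e ▸ h.mem.2), fun hy => h5 y h.mem.2 (s.roots_subset_nodes hy)⟩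
    · exact ⟨fun e => h2 (e ▸ h.mem.2), ihs h4 h⟩

theorem IsChild.parent_unique {f : OForest α} (hf : f.nodes.Nodup) {x x' y : α}
    (h : f.IsChild x y) (h' : f.IsChild x' y) : x = x' := by
  induction f with
  | nil => exact h.elim
  | node a c s ihc ihs =>
    obtain ⟨h1, h2, h3, h4, h5⟩ := nodup_node hf
    rcases h with ⟨rfl, h⟩ | h | h <;> rcases h' with ⟨rfl, h'⟩ | h' | h'
    · rfl
    · exact absurd h (h'.notMem_roots h3)
    · exact absurd h'.mem.2 (h5 y (c.roots_subset_nodes h))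
    · exact absurd h' (h.notMem_roots h3)
    · exact ihc h3 h h'
    · exact absurd h'.mem.2 (h5 y h.mem.2)
    · exact absurd h.mem.2 (h5 y (c.roots_subset_nodes h'))
    · exact absurd h.mem.2 (h5 y h'.mem.2)
    · exact ihs h4 h h'

/-- Removing a node from a forest leaves the subtrees of its children and a forest `g`, in which
the list `R` is what remains of the tree of the node (it is empty if the node is a root). -/
theorem exists_remove {f : OForest α} (hf : f.nodes.Nodup) {v : α} (hv : v ∈ f.nodes) :
    ∃ (g : OForest α) (R : List α) (root : α),
      f.nodes.Perm (v :: ((f.childSubtrees v).nodes ++ g.nodes)) ∧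
      (∀ x y, x ≠ v → y ≠ v →
        (f.IsChild x y ↔ (f.childSubtrees v).IsChild x y ∨ g.IsChild x y)) ∧
      (∀ y, y ≠ v → (y ∈ f.roots ↔ y ∈ g.roots)) ∧
      (R = [] ∨ R ∈ g.treeNodes) ∧
      f.rootOf v = some root ∧
      (root :: (f.childSubtrees root).nodes) ∈ f.treeNodes ∧
      (root :: (f.childSubtrees root).nodes).Perm (v :: ((f.childSubtrees v).nodes ++ R)) := by
  induction f with
  | nil => simp [nodes] at hv
  | node a c s ihc ihs =>
    obtain ⟨h1, h2, h3, h4, h5⟩ := nodup_node hf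
    by_cases hva : v = a
    · subst hva
      refine ⟨s, [], v, ?_, ?_, ?_, .inl rfl, by simp [rootOf], ?_, ?_⟩
      · simp [nodes, childSubtrees]
      · intro x y hx hy
        simp [IsChild, childSubtrees, hx]
      · intro y hy
        simp [roots, hy]
      · simp [childSubtrees, treeNodes]
      · simp [childSubtrees]
    by_cases hc : v ∈ c.nodes
    · obtain ⟨g, R, root, e1, e2, e3, e4, e5, e6, e7⟩ := ihc h3 hc
      have hch : (node a c s).childSubtrees v = c.childSubtrees v := by
        simp [childSubtrees, hva, hc]
      rw [hch]
      -- With `v` strictly below `a`, the rest of the tree is `a` together with what the induction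
      -- leaves of its descendants.
      refine ⟨node a g s, a :: g.nodes, a, ?_, ?_, ?_, .inr (by simp [treeNodes]),
        by simp [rootOf, hc], by simp [childSubtrees, treeNodes], ?_⟩
      · exact perm_append_of_perm_cons s.nodes e1
      · intro x y hx hy
        -- Edges from `a` lead to roots of `c`. The clause on roots is part of the induction in
        -- order to identify them, apart from `v`, with the roots of `g`.
        simp only [IsChild, e2 x y hx hy, e3 y hy]
        rw [or_assoc, or_left_comm]
      · intro y hy
        simp [roots]
      · simp only [childSubtrees, if_true]
        exact perm_cons_of_perm_cons e1
    · have hs : v ∈ s.nodes := by simpa [nodes, hva, hc] using hv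
      obtain ⟨g, R, root, e1, e2, e3, e4, e5, e6, e7⟩ := ihs h4 hs
      have hroot := mem_nodes_of_rootOf e5
      have hch : (node a c s).childSubtrees v = s.childSubtrees v := by
        simp [childSubtrees, hva, hc]
      have hch' : (node a c s).childSubtrees root = s.childSubtrees root := by
        rw [childSubtrees, if_neg (fun e : root = a => h2 (e ▸ hroot)), if_neg fun h => h5 _ h hroot]
      rw [hch]
      refine ⟨node a c g, R, root, ?_, ?_, ?_, e4.imp_right fun h => by simp [treeNodes, h],
        by simp [rootOf, hva, hc, e5], by simp [hch', treeNodes, e6],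
        by rw [hch']; exact e7⟩
      · exact perm_append_of_perm_cons_right c.nodes e1
      · intro x y hx hy
        simp only [IsChild, e2 x y hx hy]
        rw [or_left_comm (a := c.IsChild x y), or_left_comm]
      · intro y hy
        simp [roots, e3 y hy]

theorem sum_le_maxTreeSum (val : α → ℕ) {f : OForest α} {l : List α} (hl : l ∈ f.treeNodes) :
    (l.map val).sum ≤ f.maxTreeSum val := by
  induction f with
  | nil => simp [treeNodes] at hl
  | node a c s _ ih =>
    rcases List.mem_cons.1 hl with rfl | hl
    · simp [maxTreeSum]
    · exact (ih hl).trans (le_max_right _ _)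

theorem maxTreeSum_eq (val : α → ℕ) (f : OForest α) :
    f.maxTreeSum val = 0 ∨ ∃ l ∈ f.treeNodes, f.maxTreeSum val = (l.map val).sum := by
  induction f with
  | nil => simp [maxTreeSum]
  | node a c s _ ih =>
    rcases le_total (s.maxTreeSum val) (val a + (c.nodes.map val).sum) with h | h
    · exact .inr ⟨a :: c.nodes, by simp [treeNodes], by simp [maxTreeSum, h]⟩
    · rw [maxTreeSum, max_eq_right h]
      exact ih.imp_right fun ⟨l, hl, e⟩ => ⟨l, by simp [treeNodes, hl], e⟩

theorem maxTreeSum_le (val : α → ℕ) (f : OForest α) :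
    f.maxTreeSum val ≤ (f.nodes.map val).sum := by
  rcases f.maxTreeSum_eq val with h | ⟨l, hl, h⟩
  · omega
  · rw [h]
    exact ((treeNodes_sublist hl).map val).sum_le_sum (by simp)

end OForest
end DFT

namespace DFT

/-! ### Reachability in a graph and in its Block Forest -/

section Graph

variable {V : Type*} {G : SimpleGraph V}

open Relation

/-- Adjacency of vertices that lie in `A`. -/
def AdjIn (G : SimpleGraph V) (A : Set V) (u w : V) : Prop := G.Adj u w ∧ u ∈ A ∧ w ∈ A

/-- Adjacency in the Block Forest after the removal of the square nodes outside of `A`. -/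
def BlockAdjIn (G : SimpleGraph V) (A : Set V) (x y : BlockNode G) : Prop :=
  (blockForest G).Adj x y ∧ (∀ u, x = Sum.inl u → u ∈ A) ∧ ∀ u, y = Sum.inl u → u ∈ A

theorem reflTransGen_adjIn_of_preconnected {A S : Set V} (hS : (G.induce S).Preconnected)
    (hSA : S ⊆ A) {u w : V} (hu : u ∈ S) (hw : w ∈ S) : ReflTransGen (AdjIn G A) u w := by
  have h := (SimpleGraph.reachable_iff_reflTransGen _ _).1 (hS ⟨u, hu⟩ ⟨w, hw⟩)
  exact h.lift Subtype.val fun x y hxy => ⟨hxy, hSA x.2, hSA y.2⟩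

/-- The two ends of an edge form a biconnected set, since removing one leaves a single vertex; by
finiteness it extends to a maximal one. -/
theorem exists_isBlock_of_adj [Finite V] {u w : V} (h : G.Adj u w) :
    ∃ B, IsBlock G B ∧ u ∈ B ∧ w ∈ B := by
  have hb : IsBiconnectedSet G {u, w} := by
    refine ⟨⟨u, by simp, w, by simp, h.ne⟩,
      (SimpleGraph.induce_pair_connected_of_adj h).preconnected, fun x hx => ?_⟩
    have : Subsingleton ↑(({u, w} : Set V) \ {x}) := by
      refine ⟨fun a b => Subtype.ext ?_⟩
      obtain ⟨a, ha, ha'⟩ := a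
      obtain ⟨b, hb, hb'⟩ := b
      simp only [Set.mem_insert_iff, Set.mem_singleton_iff] at *
      grind
    exact SimpleGraph.Preconnected.of_subsingleton
  obtain ⟨B, hB, hmax⟩ := (Set.toFinite {B | IsBiconnectedSet G B}).exists_le_maximal hb
  exact ⟨B, hmax, hB (by simp), hB (by simp)⟩

/-- Reachability within `A` is the same in a graph and in its Block Forest, if each block stays
connected within `A`. -/
theorem reflTransGen_adjIn_iff [Finite V] {A : Set V}
    (hA : ∀ B, IsBlock G B → ∀ u ∈ B ∩ A, ∀ w ∈ B ∩ A, ReflTransGen (AdjIn G A) u w)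
    {u w : V} :
    ReflTransGen (AdjIn G A) u w ↔ ReflTransGen (BlockAdjIn G A) (Sum.inl u) (Sum.inl w) := by
  constructor
  · intro h
    induction h with
    | refl => exact .refl
    | @tail x y _ hxy ih =>
      obtain ⟨B, hB, hx, hy⟩ := exists_isBlock_of_adj hxy.1
      have hx' : (blockForest G).Adj (Sum.inl x) (Sum.inr ⟨B, hB⟩) := hx
      have hy' : (blockForest G).Adj (Sum.inr ⟨B, hB⟩) (Sum.inl y) := hy
      refine (ih.tail ⟨hx', ?_, ?_⟩).tail ⟨hy', ?_, ?_⟩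
      · rintro _ ⟨⟩; exact hxy.2.1
      · rintro _ ⟨⟩
      · rintro _ ⟨⟩
      · rintro _ ⟨⟩; exact hxy.2.2
  · intro h
    -- The induction needs a statement for round nodes too: reaching a block means reaching all its
    -- vertices in `A`.
    have key : ∀ y, ReflTransGen (BlockAdjIn G A) (Sum.inl u) y →
        match y with
        | Sum.inl w => ReflTransGen (AdjIn G A) u w
        | Sum.inr B => ∀ w ∈ B.1 ∩ A, ReflTransGen (AdjIn G A) u w := by
      intro y hy
      induction hy with
      | refl => exact .refl
      | @tail x y _ hxy ih =>
        rcases x with x | B <;> rcases y with y | B'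
        · exact hxy.1.elim
        · intro z hz
          exact ReflTransGen.trans ih (hA B'.1 B'.2 x ⟨hxy.1, hxy.2.1 x rfl⟩ z hz)
        · exact ih y ⟨hxy.1, hxy.2.2 y rfl⟩
        · exact hxy.1.elim
    exact key _ h

theorem reachable_iff_block [Finite V] {u w : V} :
    G.Reachable u w ↔ ReflTransGen (blockForest G).Adj (Sum.inl u) (Sum.inl w) := by
  rw [SimpleGraph.reachable_iff_reflTransGen]
  have h := reflTransGen_adjIn_iff (G := G) (A := Set.univ) (u := u) (w := w)
    (fun B hB x hx y hy =>
      reflTransGen_adjIn_of_preconnected hB.prop.2.1 (Set.subset_univ B) hx.1 hy.1)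
  have e₁ : AdjIn G Set.univ = G.Adj := by
    funext x y
    simp [AdjIn]
  have e₂ : BlockAdjIn G Set.univ = (blockForest G).Adj := by
    funext x y
    simp [BlockAdjIn]
  rwa [e₁, e₂] at h

/-- The general comparison applies with `A` the complement of `v`: a block containing `v` stays
connected without it by definition, and any other block is unaffected. -/
theorem reachable_induce_compl_iff_block [Finite V] {v : V} {u w : ({v}ᶜ : Set V)} :
    (G.induce ({v}ᶜ : Set V)).Reachable u w ↔
      ReflTransGen (fun x y => (blockForest G).Adj x y ∧ x ≠ Sum.inl v ∧ y ≠ Sum.inl v)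
        (Sum.inl u.1) (Sum.inl w.1) := by
  have h := reflTransGen_adjIn_iff (G := G) (A := {v}ᶜ) (u := u.1) (w := w.1) (by
    intro B hB x hx y hy
    by_cases hv : v ∈ B
    · exact reflTransGen_adjIn_of_preconnected (hB.prop.2.2 v hv) (fun z hz => hz.2)
        ⟨hx.1, hx.2⟩ ⟨hy.1, hy.2⟩
    · exact reflTransGen_adjIn_of_preconnected hB.prop.2.1
        (fun z hz => by rintro rfl; exact hv hz) hx.1 hy.1)
  have e : BlockAdjIn G {v}ᶜ =
      fun x y => (blockForest G).Adj x y ∧ x ≠ Sum.inl v ∧ y ≠ Sum.inl v := by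
    funext x y
    have key : ∀ x : BlockNode G, (∀ u, x = Sum.inl u → u ∈ ({v}ᶜ : Set V)) ↔ x ≠ Sum.inl v :=
      fun x => ⟨fun h e => h v e rfl, fun h u e hu => h (by rw [e, hu])⟩
    rw [BlockAdjIn, key, key]
  rw [← e, ← h, SimpleGraph.reachable_iff_reflTransGen]
  constructor
  · intro h
    exact h.lift Subtype.val fun x y hxy => ⟨hxy, x.2, y.2⟩
  · intro h
    obtain ⟨w, hw⟩ := w
    -- Membership of the endpoint is quantified inside, so that the induction can lift a path in `V`
    -- to the subtype step by step.
    have key : ∀ y, ReflTransGen (AdjIn G {v}ᶜ) u.1 y → ∀ hy : y ∈ ({v}ᶜ : Set V),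
        ReflTransGen (G.induce ({v}ᶜ : Set V)).Adj u ⟨y, hy⟩ := by
      intro y h
      induction h with
      | refl => exact fun _ => .refl
      | tail _ hxy ih => exact fun hy => (ih hxy.2.1).tail hxy.1
    exact key w h hw

/-! ### The number of nodes of the Block Forest -/

/-- A block has at least two vertices, at most one of which is its parent, so some vertex is its
child. As a vertex has only one parent, choosing such a child is injective. -/
theorem card_blocks_le [Fintype V] [Fintype {B : Set V // IsBlock G B}]
    {f : OForest (BlockNode G)} (hf : Represents f (blockForest G)) :
    Fintype.card {B : Set V // IsBlock G B} ≤ Fintype.card V := by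
  have key : ∀ B : {B : Set V // IsBlock G B}, ∃ u : V, f.IsChild (Sum.inr B) (Sum.inl u) := by
    intro B
    obtain ⟨x, hx, y, hy, hxy⟩ := B.2.prop.1
    have hx' : (blockForest G).Adj (Sum.inr B) (Sum.inl x) := hx
    have hy' : (blockForest G).Adj (Sum.inr B) (Sum.inl y) := hy
    rcases (hf.2.2 _ _).1 hx' with h | h
    · exact ⟨x, h⟩
    rcases (hf.2.2 _ _).1 hy' with h' | h'
    · exact ⟨y, h'⟩
    · exact absurd (Sum.inl_injective (h.parent_unique hf.1 h')) hxy
  choose c hc using key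
  refine Fintype.card_le_of_injective c fun B B' h => ?_
  have h1 := hc B
  rw [h] at h1
  exact Sum.inr_injective (h1.parent_unique hf.1 (hc B'))

theorem length_nodes_le [Fintype V] {f : OForest (BlockNode G)}
    (hf : Represents f (blockForest G)) : f.nodes.length ≤ 2 * Fintype.card V := by
  classical
  have := hf.1.length_le_card
  rw [Fintype.card_sum] at this
  have := card_blocks_le hf
  omega

/-! ### The impact -/

open Classical in
theorem sum_blockVal {l : List (BlockNode G)} (hl : l.Nodup) [Fintype V] :
    (l.map (blockVal G)).sum = (Finset.univ.filter fun u : V => Sum.inl u ∈ l).card := by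
  induction l with
  | nil => simp
  | cons x l ih =>
    rw [List.map_cons, List.sum_cons, ih hl.of_cons]
    rcases x with u | B
    · have hu : Sum.inl u ∉ l := (List.nodup_cons.1 hl).1
      have e : (Finset.univ.filter fun w : V => (Sum.inl w : BlockNode G) ∈ Sum.inl u :: l) =
          insert u (Finset.univ.filter fun w : V => (Sum.inl w : BlockNode G) ∈ l) := by
        ext w
        simp
      rw [e, Finset.card_insert_of_notMem (by simpa using hu)]
      simp [blockVal, add_comm]
    · simp [blockVal]

/-- The impact of `v` in terms of the sums of values in the Block Forest. -/
theorem impact_eq [Fintype V] {f : OForest (BlockNode G)} (hf : Represents f (blockForest G))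
    {v : V} {root : BlockNode G} (hroot : f.rootOf (Sum.inl v) = some root) :
    (impact G v : ℤ) = ((f.subtreeSum (blockVal G) root : ℤ) - 1) -
      max (f.maxsumChild (blockVal G) (Sum.inl v) : ℤ)
        (f.subtreeSum (blockVal G) root - f.subtreeSum (blockVal G) (Sum.inl v)) := by
  classical
  obtain ⟨hn, hall, hadj⟩ := hf
  -- Without `v`, the forest consists of the trees of its children and of `g`. The pieces are to be
  -- matched with the child trees and with `R`, which is the rest of the tree of `v`.
  obtain ⟨g, R, root', e1, e2, -, e4, e5, e6, e7⟩ := OForest.exists_remove hn (hall (Sum.inl v))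
  obtain rfl : root' = root := Option.some_injective _ (e5.symm.trans hroot)
  set c := f.childSubtrees (Sum.inl v) with hc
  set T := root' :: (f.childSubtrees root').nodes with hT
  have hnF := e1.nodup_iff.1 hn
  have hnT : T.Nodup := hn.sublist (OForest.treeNodes_sublist e6)
  have hvT : Sum.inl v ∈ T := e7.mem_iff.2 (by simp)
  -- the sums
  have hS : f.subtreeSum (blockVal G) root' =
      1 + ((c.nodes.map (blockVal G)).sum + (R.map (blockVal G)).sum) := by
    rw [OForest.subtreeSum, (e7.map (blockVal G)).sum_eq]
    simp [blockVal]
  have hs : f.subtreeSum (blockVal G) (Sum.inl v) = 1 + (c.nodes.map (blockVal G)).sum := by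
    simp [OForest.subtreeSum, blockVal, hc]
  have hm : f.maxsumChild (blockVal G) (Sum.inl v) = c.maxTreeSum (blockVal G) :=
    OForest.maxsumChild_eq _ _ _
  have hmle := c.maxTreeSum_le (blockVal G)
  -- the connected component of `v`
  have hreach : ∀ u : V, G.Reachable v u ↔ Sum.inl u ∈ T := by
    intro u
    rw [reachable_iff_block, ← OForest.reflTransGen_adj_iff hn e6 hvT]
    have : (blockForest G).Adj = f.Adj := by
      funext x y
      exact propext (hadj x y)
    rw [this]
  -- the connected components after the removal of `v`
  have hnF' : (c.append g).nodes.Nodup := by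
    rw [OForest.nodes_append]
    exact hnF.of_cons
  have hvF : Sum.inl v ∉ (c.append g).nodes := by
    rw [OForest.nodes_append]
    exact (List.nodup_cons.1 hnF).1
  have hadjF : (fun x y => (blockForest G).Adj x y ∧ x ≠ Sum.inl v ∧ y ≠ Sum.inl v) =
      (c.append g).Adj := by
    funext x y
    refine propext ⟨fun ⟨h, hx, hy⟩ => ?_, fun h => ?_⟩
    · simp only [OForest.Adj, OForest.isChild_append]
      exact ((hadj x y).1 h).imp (e2 x y hx hy).1 (e2 y x hy hx).1
    · have hmem : x ∈ (c.append g).nodes ∧ y ∈ (c.append g).nodes :=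
        h.elim (fun h => h.mem) fun h => h.mem.symm
      have hx : x ≠ Sum.inl v := fun e => hvF (e ▸ hmem.1)
      have hy : y ≠ Sum.inl v := fun e => hvF (e ▸ hmem.2)
      simp only [OForest.Adj, OForest.isChild_append] at h
      exact ⟨(hadj x y).2 (h.imp (e2 x y hx hy).2 (e2 y x hy hx).2), hx, hy⟩
  have hcomp : ∀ (u : ({v}ᶜ : Set V)) (l : List (BlockNode G)), l ∈ (c.append g).treeNodes →
      Sum.inl u.1 ∈ l → ((G.induce ({v}ᶜ : Set V)).connectedComponentMk u).supp.ncard =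
        (l.map (blockVal G)).sum := by
    intro u l hl hu
    have hlF := OForest.treeNodes_sublist hl
    rw [sum_blockVal (hnF'.sublist hlF), ← Set.ncard_coe_finset,
      ← Set.ncard_image_of_injective _ Subtype.val_injective]
    congr 1
    ext w
    simp only [Set.mem_image, SimpleGraph.ConnectedComponent.mem_supp_iff,
      SimpleGraph.ConnectedComponent.eq, Finset.coe_filter, Finset.mem_univ, true_and,
      Set.mem_ofPred_eq]
    have key : ∀ w : ({v}ᶜ : Set V), (G.induce ({v}ᶜ : Set V)).Reachable w u ↔
        Sum.inl w.1 ∈ l := by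
      intro w
      rw [SimpleGraph.reachable_comm, reachable_induce_compl_iff_block, hadjF,
        OForest.reflTransGen_adj_iff hnF' hl hu]
    constructor
    · rintro ⟨w, hw, rfl⟩
      exact (key w).1 hw
    · intro hw
      have hwv : w ≠ v := fun e => hvF (e ▸ hlF.subset hw)
      exact ⟨⟨w, hwv⟩, (key ⟨w, hwv⟩).2 hw, rfl⟩
  have hpiece : ∀ u : ({v}ᶜ : Set V),
      (G.induce ({v}ᶜ : Set V)).connectedComponentMk u ∈ pieces G v ↔ G.Reachable v u := by
    intro u
    constructor
    · rintro ⟨w, hw, hvw⟩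
      have h := SimpleGraph.ConnectedComponent.exact hw
      exact hvw.trans (h.map (SimpleGraph.Embedding.induce _).toHom)
    · intro h
      exact ⟨u, rfl, h⟩
  -- the sum of the sizes
  have hsum : ∑ p ∈ (pieces G v).toFinite.toFinset, p.supp.ncard =
      (c.nodes.map (blockVal G)).sum + (R.map (blockVal G)).sum := by
    have hmaps : Set.MapsTo (G.induce ({v}ᶜ : Set V)).connectedComponentMk
        ((Finset.univ.filter fun u : ({v}ᶜ : Set V) => G.Reachable v u.1) : Finset _)
        ((pieces G v).toFinite.toFinset : Finset _) := by
      intro u hu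
      simpa [hpiece] using hu
    -- The pieces partition the vertices reachable from `v` other than `v`, so their sizes add up to
    -- the square nodes of `T` minus one.
    have hU := Finset.card_eq_sum_card_fiberwise hmaps
    have hfib : ∀ p ∈ (pieces G v).toFinite.toFinset,
        p.supp.ncard = ((Finset.univ.filter fun u : ({v}ᶜ : Set V) => G.Reachable v u.1).filter
          fun u => (G.induce ({v}ᶜ : Set V)).connectedComponentMk u = p).card := by
      intro p hp
      rw [← Set.ncard_coe_finset]
      congr 1
      ext u
      have hp' : p ∈ pieces G v := by simpa using hp
      simp only [SimpleGraph.ConnectedComponent.mem_supp_iff, Finset.coe_filter,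
        Finset.mem_filter, Finset.mem_univ, true_and, Set.mem_ofPred_eq]
      exact ⟨fun h => ⟨(hpiece u).1 (h ▸ hp'), h⟩, fun h => h.2⟩
    rw [Finset.sum_congr rfl hfib, ← hU]
    have hT1 := sum_blockVal hnT
    have hT2 : (T.map (blockVal G)).sum =
        1 + ((c.nodes.map (blockVal G)).sum + (R.map (blockVal G)).sum) := by
      rw [← hS, OForest.subtreeSum]
    have himg : (Finset.univ.filter fun u : ({v}ᶜ : Set V) => G.Reachable v u.1).image
        Subtype.val = (Finset.univ.filter fun u : V => Sum.inl u ∈ T).erase v := by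
      ext u
      simp [hreach, and_comm]
    rw [← Finset.card_image_of_injective _ Subtype.val_injective, himg,
      Finset.card_erase_of_mem (by simpa using hvT), ← hT1, hT2]
    omega
  -- the largest size
  have hge : ∀ l ∈ (c.append g).treeNodes, (∀ x ∈ l, x ∈ T) → (l.map (blockVal G)).sum ≤
      (pieces G v).toFinite.toFinset.sup fun p => p.supp.ncard := by
    intro l hl hlT
    -- A tree without square nodes would match no piece, but its sum 0 does not affect the maximum.
    rcases Nat.eq_zero_or_pos (l.map (blockVal G)).sum with h0 | h0
    · omega
    obtain ⟨x, hx, hx0⟩ : ∃ x ∈ l, blockVal G x ≠ 0 := by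
      by_contra! hcon
      refine h0.ne' (List.sum_eq_zero fun y hy => ?_)
      obtain ⟨x, hx, rfl⟩ := List.mem_map.1 hy
      exact hcon x hx
    rcases x with u | B
    · have huv : u ≠ v := fun e => hvF (e ▸ (OForest.treeNodes_sublist hl).subset hx)
      rw [← hcomp ⟨u, huv⟩ l hl hx]
      refine Finset.le_sup (f := fun p : (G.induce ({v}ᶜ : Set V)).ConnectedComponent =>
        p.supp.ncard) ?_
      rw [Set.Finite.mem_toFinset, hpiece]
      exact (hreach u).2 (hlT _ hx)
    · exact absurd rfl hx0
  have hsup : (pieces G v).toFinite.toFinset.sup (fun p => p.supp.ncard) =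
      max (c.maxTreeSum (blockVal G)) (R.map (blockVal G)).sum := by
    apply le_antisymm
    · refine Finset.sup_le fun p hp => ?_
      obtain ⟨u, rfl⟩ := p.exists_rep
      have hu : Sum.inl u.1 ∈ T := by
        rw [← hreach, ← hpiece]
        exact (Set.Finite.mem_toFinset _).1 hp
      have huv : (Sum.inl u.1 : BlockNode G) ≠ Sum.inl v := fun e => u.2 (Sum.inl_injective e)
      rcases List.mem_append.1 ((List.mem_cons.1 (e7.mem_iff.1 hu)).resolve_left huv) with h | h
      · obtain ⟨l, hl, hul⟩ := OForest.mem_nodes_iff.1 h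
        refine le_max_of_le_left ?_
        exact (hcomp u l (by simp [OForest.treeNodes_append, hl]) hul).le.trans
          (OForest.sum_le_maxTreeSum _ hl)
      · refine le_max_of_le_right ?_
        have hR : R ∈ g.treeNodes := e4.resolve_left fun e => by simp [e] at h
        exact (hcomp u R (by simp [OForest.treeNodes_append, hR]) h).le
    · refine max_le ?_ ?_
      · rcases c.maxTreeSum_eq (blockVal G) with h | ⟨l, hl, h⟩
        · omega
        · rw [h]
          exact hge l (by simp [OForest.treeNodes_append, hl]) fun x hx =>
            e7.mem_iff.2 (by simp [(OForest.treeNodes_sublist hl).subset hx])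
      · rcases e4 with h | h
        · simp [h]
        · exact hge R (by simp [OForest.treeNodes_append, h]) fun x hx =>
            e7.mem_iff.2 (by simp [hx])
  -- Now S - s is the sum over `R`. By `hmle` the maximum is at most the total, so the truncated
  -- subtraction in `impact` is exact.
  rw [impact, hsum, hsup, hS, hs, hm]
  omega

end Graph
end DFT

/-! ### Logarithmic bounds and the main theorem -/

namespace DFT

theorem length_inorder {β : Type*} : ∀ t : BinaryTree β, (inorder t).length = t.numNodes
  | .nil => rfl
  | .node q l r => by
    simp [inorder, BinaryTree.numNodes, length_inorder l, length_inorder r]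
    omega

theorem height_le_of_balanced {V : Type*} [Fintype V] {G : SimpleGraph V} {K : ℕ}
    {D : List (Part (BlockNode G))} (hrep : Represents (forestOf D) (blockForest G))
    (hbal : Balanced K D) {p : Part (BlockNode G)} (hp : p ∈ D) (hV : 0 < Fintype.card V) :
    p.bst.height ≤ K * (Nat.log 2 (Fintype.card V) + 3) := by
  -- At most 2n forest nodes with two tour entries each. The resulting factor 4 adds 2 to the binary
  -- logarithm.
  have h1 : p.bst.numNodes ≤ Fintype.card V * 2 * 2 := by
    rw [← length_inorder, p.inorder_bst, OForest.length_tour]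
    have := (sublist_nodes_forestOf hp).length_le
    have := length_nodes_le hrep
    omega
  have h2 : Nat.log 2 p.bst.numNodes ≤ Nat.log 2 (Fintype.card V) + 2 := by
    refine (Nat.log_mono_right h1).trans ?_
    rw [Nat.log_mul_base (by norm_num) (by omega), Nat.log_mul_base (by norm_num) (by omega)]
  exact (hbal p hp).trans (Nat.mul_le_mul_left _ (by omega))

/-- Both `log 2 * Nat.log 2 n` and, since `n ≥ 1`, `log 2` are at most `log (n + 1)`; hence the
factor 2. -/
theorem log_two_mul_natLog_le {n : ℕ} (hn : 0 < n) :
    Real.log 2 * (Nat.log 2 n + 1 : ℝ) ≤ 2 * Real.log (n + 1) := by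
  have h1 : (2 : ℝ) ^ Nat.log 2 n ≤ n + 1 := by
    have := Nat.pow_log_le_self 2 hn.ne'
    have : ((2 ^ Nat.log 2 n : ℕ) : ℝ) ≤ n := by exact_mod_cast this
    push_cast at this
    linarith
  have h2 := Real.log_le_log (by positivity) h1
  rw [Real.log_pow] at h2
  have h3 : Real.log 2 ≤ Real.log (n + 1) := by
    refine Real.log_le_log (by norm_num) ?_
    have : (1 : ℝ) ≤ n := by exact_mod_cast hn
    linarith
  nlinarith

end DFT

/-- One fixed program answers impact queries on DFT-Trees of Block Forests in time `O(log n)`. Its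
input, in register 0, is the address of the open-node of the square node of `v`. It also returns the
quantities from which the impact is computed: the root (its open-node) in register 1, the
subtree-size of the root in register 2, the subtree-size of `v` in register 3, and the maxsum-child
of `v` in register 4. -/
theorem mainTheorem1 :
    ∃ P : DFT.Prog, ∀ K : ℕ, ∃ C : ℝ,
      ∀ (V : Type*) [Fintype V] (G : SimpleGraph V)
        (D : List (DFT.Part (DFT.BlockNode G))) (addr : DFT.Paren (DFT.BlockNode G) → ℤ)
        (h : DFT.Heap) (v : V) (s : DFT.Regs),
        DFT.IsBlockDFTTree G K D addr h → s 0 = addr ⟨Sum.inl v, true⟩ →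
        ∃ (root : DFT.BlockNode G) (t : ℕ) (s' : DFT.Regs),
          (DFT.forestOf D).rootOf (Sum.inl v) = some root ∧
          DFT.Exec h P s t s' ∧
          (t : ℝ) ≤ C * Real.log ((Fintype.card V : ℝ) + 1) ∧
          s' 0 = DFT.impact G v ∧
          s' 1 = addr ⟨root, true⟩ ∧
          s' 2 = (DFT.forestOf D).subtreeSum (DFT.blockVal G) root ∧
          s' 3 = (DFT.forestOf D).subtreeSum (DFT.blockVal G) (Sum.inl v) ∧
          s' 4 = (DFT.forestOf D).maxsumChild (DFT.blockVal G) (Sum.inl v) ∧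
          s' 0 = (s' 2 - 1) - max (s' 4) (s' 2 - s' 3) := by
  -- With a the binary logarithm of n, the height is at most K(a + 3) ≤ 3K(a + 1), which gives the
  -- factor `K * 3`. The factor 2 / log 2 converts a + 1 into log(n + 1).
  refine ⟨DFT.Prog.query, fun K =>
    ⟨2 * (3 * DFT.stepCost * K * 3 + DFT.Prog.query.cost : ℕ) / Real.log 2, ?_⟩⟩
  intro V _ G D addr h v s hD hs
  have hV : 0 < Fintype.card V := Fintype.card_pos_iff.2 ⟨v⟩
  obtain ⟨p, hp, root, hroot, t, s', he, ht, h1, h2, h3, h4, h0⟩ :=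
    DFT.exists_query_runs hD.addr_injective hD.addr_ne_null hD.represents.1 hD.stored
      (hD.represents.2.1 (Sum.inl v)) hs
  refine ⟨root, t, s', hroot, he, ?_, ?_, h1, h2, h3, h4, h0⟩
  · have hh := DFT.height_le_of_balanced hD.represents hD.balanced hp hV
    have ht' : t ≤ (3 * DFT.stepCost * K * 3 + DFT.Prog.query.cost) *
        (Nat.log 2 (Fintype.card V) + 1) := by
      generalize Nat.log 2 (Fintype.card V) = a at *
      generalize DFT.Prog.query.cost = b at *
      have := Nat.mul_le_mul_left (3 * DFT.stepCost) hh
      nlinarith [Nat.zero_le (b * a), Nat.zero_le (3 * DFT.stepCost * K * a)]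
    generalize 3 * DFT.stepCost * K * 3 + DFT.Prog.query.cost = c at ht' ⊢
    have ht'' : (t : ℝ) ≤ c * (Nat.log 2 (Fintype.card V) + 1) := by exact_mod_cast ht'
    have hl2 : 0 < Real.log 2 := Real.log_pos (by norm_num)
    rw [div_mul_eq_mul_div, le_div_iff₀ hl2]
    have := DFT.log_two_mul_natLog_le hV
    calc (t : ℝ) * Real.log 2
        ≤ (c * (Nat.log 2 (Fintype.card V) + 1)) * Real.log 2 := by gcongr
      _ = c * (Real.log 2 * (Nat.log 2 (Fintype.card V) + 1)) := by ring
      _ ≤ c * (2 * Real.log (Fintype.card V + 1)) := by gcongr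
      _ = 2 * c * Real.log (Fintype.card V + 1) := by ring
  · rw [h0, h2, h3, h4, DFT.impact_eq hD.represents hroot]
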